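/- Let $\mathcal H$ be a separable complex Hilbert space and $A$ a bounded self-adjoint operator on $\mathcal H$. Write $\sigma(\cdot)$ for the spectrum, $\sigma_p(\cdot)$ for the set of eigenvalues, and $\sigma_e(\cdot)$ for the essential spectrum (the set of $\lambda$ such that $\lambda I-T$ is not Fredholm). For infinite sets $B=\{b_1<b_2<\dots\}$, $C=\{c_1<c_2<\dots\}$ of positive integers and an orthonormal basis $(e_n)_{n\ge1}$ of $\mathcal H$, the spread $S_{B,C}$ is the bounded operator with $S_{B,C}e_{b_k}=e_{c_k}$ for all $k$ and $S_{B,C}e_n=0$ for $n\notin B$. A unitary operator $U$ is a unitary spread if, for some orthonormal basis of $\mathcal H$, there are spreads $S_{B_n,C_n}$ ($n\ge1$) with $U=\sum_{n=1}^\infty S_{B_n,C_n}$ in the strong operator topology. By a ring in $R^o_{\lambda_1,\lambda_2}=\{\lambda\in\mathbb C:\lambda_1<|\lambda|<\lambda_2\}$ we mean a set $R=\{\lambda\in\mathbb C: a<|\lambda|<b\}$ with $\lambda_1\le a<b\le\lambda_2$. (i) If $\sigma(A)\subseteq[\lambda_1,\lambda_2]$, $\lambda_1>0$ and $\lambda_1,\lambda_2\in\sigma_e(A)$,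 then for every ring $R$ in $R^o_{\lambda_1,\lambda_2}$ there is a unitary spread $U$ with $\sigma_p(UA)=R$. (ii) Let $\lambda_1,\lambda_2\in\sigma_e(A)$ and $0<\lambda_1<\lambda_2$. Then there is a unitary spread $U$ such that $\sigma_p(UA)\supseteq R$ for every ring $R$ in $R^o_{\lambda_1,\lambda_2}$. If moreover $A$ is injective and there are sequences $(t_k)$, $(r_k)$ in $\sigma(A)$ with $t_k>t_{k+1}$ and $r_k<r_{k+1}$ for all $k$, then for every ring $R$ in $R^o_{\lambda_1,\lambda_2}$ there is a unitary spread $U$ with $\sigma_p(UA)=R$. Finally, if $\sigma(A)\subseteq[\lambda_1,\lambda_2]$, then for every unitary operator $U$ on $\mathcal H$ one has $\sigma_p(UA)\subseteq\{\lambda:\lambda_1\le|\lambda|\le\lambda_2\}$ and, for $i=1,2$, $\operatorname{Card}\big(\sigma_p(UA)\cap\{|\lambda|=\lambda_i\}\big)\le\dim\operatorname{Ker}(\lambda_iI-A)$, where $\dim$ is the Hilbert space dimension (the cardinality of an orthonormal basis). (iii) Let $A$ be injective, $\lambda_1>0$ and $\sigma_e(A)=\{\lambda_1\}$, and let $(t_k)_{k\ge1}$,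 $(r_k)_{k\ge1}$ be sequences in $\sigma(A)$ with $t_k<t_{k+1}$, $r_k>r_{k+1}$ for all $k$, $t_k\to\lambda_1$, $r_k\to\lambda_1$, $$\sum_{n=1}^\infty\prod_{k=1}^n\Big(\frac{t_k}{\lambda_1}\Big)^2<\infty\quad\text{and}\quad \sum_{n=1}^\infty\prod_{k=1}^n\Big(\frac{\lambda_1}{r_k}\Big)^2<\infty .$$ Then there is a unitary spread $U$ with $\sigma_p(UA)=\{\lambda\in\mathbb C:|\lambda|=\lambda_1\}$. -/

import Mathlib

open Filter Topology

universe u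

noncomputable section SpreadDefs

variable {H : Type u} [NormedAddCommGroup H] [InnerProductSpace ℂ H]

/-- The point spectrum (set of eigenvalues) of a bounded operator. -/
def pointSpectrum (T : H →L[ℂ] H) : Set ℂ :=
  {z | Module.End.HasEigenvalue (T : H →ₗ[ℂ] H) z}

/-- The essential spectrum: all `z` such that `z - T` is not a Fredholm operator. -/
def essentialSpectrum (T : H →L[ℂ] H) : Set ℂ :=
  {z | ¬ (z • ContinuousLinearMap.id ℂ H - T).IsFredholm}

/-- `S` is the (bounded) spread from `A` to `B` with respect to the orthonormal basis `e`:
writing `A = {a₀ < a₁ < ...}` and `B = {b₀ < b₁ < ...}`, it maps `e (a k)` to `e (b k)` for all `k`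
and `e n` to `0` for `n ∉ A`. -/
def IsSpread (e : HilbertBasis ℕ ℂ H) (A B : Set ℕ) (S : H →L[ℂ] H) : Prop :=
  A.Infinite ∧ B.Infinite ∧ (∀ n, n ∉ A → S (e n) = 0) ∧
    ∀ k, S (e (Nat.nth (fun n => n ∈ A) k)) = e (Nat.nth (fun n => n ∈ B) k)

/-- `U` is a unitary spread: it is unitary and, for some orthonormal basis, it is the sum of a
series of spreads that converges in the strong operator topology. -/
def IsUnitarySpread [CompleteSpace H] (U : H →L[ℂ] H) : Prop :=
  U ∈ unitary (H →L[ℂ] H) ∧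
    ∃ (e : HilbertBasis ℕ ℂ H) (A B : ℕ → Set ℕ) (S : ℕ → H →L[ℂ] H),
      (∀ n, IsSpread e (A n) (B n) (S n)) ∧
      ∀ x : H, Tendsto (fun N => ∑ n ∈ Finset.range N, S n x) atTop (𝓝 (U x))

/-- The Hilbert space dimension: the cardinality of an orthonormal (Hilbert) basis. -/
def hilbertDim (K : Type u) [NormedAddCommGroup K] [InnerProductSpace ℂ K] [CompleteSpace K] :
    Cardinal.{u} :=
  Cardinal.mk (exists_hilbertBasis ℂ K).choose

end SpreadDefs

/-- The open ring `{z | a < |z| < b}`. -/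
def openRing (a b : ℝ) : Set ℂ := {z | a < ‖z‖ ∧ ‖z‖ < b}

/-- The closed ring `{z | a ≤ |z| ≤ b}`. -/
def closedRing (a b : ℝ) : Set ℂ := {z | a ≤ ‖z‖ ∧ ‖z‖ ≤ b}

/-- The circle `{z | |z| = r}`. -/
def circleOfRadius (r : ℝ) : Set ℂ := {z | ‖z‖ = r}

/-!
The operator `U A` with the prescribed eigenvalues is built as a bilateral operator-weighted shift.

A unitary operator that permutes an orthonormal basis is a unitary spread, since every permutation
of `ℕ` splits into infinitely many increasing maps between infinite sets
(`exists_infinite_monotone_coloring`, `isUnitarySpread_of_perm`). In particular a bilateral shift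
of position spaces `W n`, `n : ℤ`, is one (`exists_unitarySpread_of_shift`).

For a point `s` of the essential spectrum of the self-adjoint operator `A`, all spectral subspaces
of `[s - d, s + d]` are infinite dimensional, and they contain a sequence of mutually orthogonal
invariant subspaces on which `A` is closer and closer to `s` (`exists_orthogonal_seq_spectralSub`).
Such invariant subspaces are distributed over blocks `K (n, m)`, with `n` the position and `m` the
home of a family of side chains. In the diagonal blocks unit vectors `u n`, `v n` are singled out
with `A (u n) = w n • v n`, and `U` is chosen to map `v n` to `u (n + 1)`, the complement of `v n`
in `K (n, n)` to the block `K (n + 1, n)`, the block `K (n - 1, n)` to the complement of `u n` in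
`K (n, n)`, and the other blocks `K (n, m)` to `K (n + 1, m)` (`exists_isShiftModel`). Hence `U A`
acts as a weighted shift on the main chain spanned by the `u n`, and `z` is an eigenvalue as soon
as `z * c (n + 1) = w n * c n` has a nonzero square-summable solution. The side chains of a fixed
home meet the main chain only there, so the components of an eigenvector along them satisfy a norm
recurrence whose behaviour at `±∞` is read off from the blocks
(`IsShiftModel.of_mem_pointSpectrum`).

For `l₁ < l₂` in the essential spectrum the side chains are near `l₁` at `-∞` and near `l₂` at
`+∞`: a component of an eigenvector along them would grow at `+∞` or at `-∞`, so there is none if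
`A` is injective. The weights of the main chain are chosen in `(a, b)`, as norms `‖A x‖` of unit
vectors mixed from the parts near `l₁` and near `l₂`, with limit `a` at `+∞` and `b` at `-∞`; then
the recurrence has solutions in `ℓ²` exactly for `a < ‖z‖ < b` (`exists_unitarySpread_ring`).

If `l` is the only essential point, the numbers `t k` and `r k` are eigenvalues, their eigenvectors
form the main chain, and the summability conditions say that its recurrence has solutions in `ℓ²`
for `‖z‖ = l`. The orthogonal complement of the main chain provides side chains that are near `l`
at both ends if it is infinite dimensional; if it is finite dimensional, it is diagonalised and its
eigenvectors are inserted into the main chain (`exists_unitarySpread_circle_of_spectrum`). All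
weights tend to `l`, so there are no eigenvalues off the circle.

For an arbitrary unitary `U` and `σ(A) ⊆ [l₁, l₂]`, an eigenvector `x` of `U A` for `z` satisfies
`‖A x‖ = ‖z‖ * ‖x‖`, hence `l₁ ≤ ‖z‖ ≤ l₂`. If `‖z‖` is one of the end points `l`, then `A x = l x`
(`map_eq_smul_of_norm_map_eq`), so `x` is also an eigenvector of `U`, and eigenvectors of `U` for
different eigenvalues are orthogonal.
-/

/-! ### Spectral subspaces and the essential spectrum -/

section SpectralSubspaces
variable {H : Type u} [NormedAddCommGroup H] [InnerProductSpace ℂ H] [CompleteSpace H]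

/-- The spectral subspace of `A` for the interval `[s - d, s + d]`, encoded as the kernel of
`e(A)`, where `e(t) = max (|t - s| - d) 0` is a continuous function vanishing exactly there. -/
noncomputable def spectralSub (A : H →L[ℂ] H) (s d : ℝ) : Submodule ℂ H :=
  (cfc (fun t : ℝ => max (|t - s| - d) 0) A).ker

theorem mem_spectralSub {A : H →L[ℂ] H} {s d : ℝ} {x : H} :
    x ∈ spectralSub A s d ↔ cfc (fun t : ℝ => max (|t - s| - d) 0) A x = 0 := Iff.rfl

theorem isClosed_spectralSub (A : H →L[ℂ] H) (s d : ℝ) :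
    IsClosed (spectralSub A s d : Set H) :=
  (cfc (fun t : ℝ => max (|t - s| - d) 0) A).isClosed_ker

theorem cfc_mul_apply (A : H →L[ℂ] H) {f g : ℝ → ℝ} (hf : Continuous f) (hg : Continuous g)
    (x : H) : cfc (fun t => f t * g t) A x = cfc f A (cfc g A x) := by
  rw [cfc_mul f g A hf.continuousOn hg.continuousOn]; rfl

theorem cfc_sub_const_apply {A : H →L[ℂ] H} (hA : IsSelfAdjoint A) (s : ℝ) (x : H) :
    cfc (fun t : ℝ => t - s) A x = A x - (s : ℂ) • x := by
  rw [cfc_sub (fun t : ℝ => t) (fun _ => s) A, cfc_id' ℝ A, cfc_const s A]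
  simp [Algebra.algebraMap_eq_smul_one]

theorem map_mem_spectralSub {A : H →L[ℂ] H} (s d : ℝ) {B : H →L[ℂ] H}
    (hB : Commute A B) {x : H} (hx : x ∈ spectralSub A s d) : B x ∈ spectralSub A s d := by
  rw [mem_spectralSub] at hx ⊢
  have h : Commute (cfc (fun t : ℝ => max (|t - s| - d) 0) A) B := hB.cfc_real _
  have : (cfc (fun t : ℝ => max (|t - s| - d) 0) A) (B x) = B (cfc _ A x) :=
    congrArg (fun T : H →L[ℂ] H => T x) h.eq
  rw [this, hx, map_zero]

theorem spectralSub_mono (A : H →L[ℂ] H) (s : ℝ) {d d' : ℝ} (h : d ≤ d') :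
    spectralSub A s d ≤ spectralSub A s d' := by
  rcases h.eq_or_lt with rfl | h
  · exact le_rfl
  intro x hx
  rw [mem_spectralSub] at hx ⊢
  have hpos : ∀ t : ℝ, 0 < max (max (|t - s| - d) 0) (d' - d) :=
    fun t => lt_max_of_lt_right (by linarith)
  have key : (fun t : ℝ => max (|t - s| - d') 0) = fun t : ℝ =>
      (max (|t - s| - d') 0 / max (max (|t - s| - d) 0) (d' - d)) * max (|t - s| - d) 0 := by
    funext t
    rcases le_or_gt (|t - s|) d' with h1 | h1
    · rw [max_eq_right (by linarith)]; simp
    · rw [max_eq_left (a := |t - s| - d) (by linarith),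
        max_eq_left (a := |t - s| - d) (by linarith), div_mul_cancel₀ _ (by linarith)]
  have hc : Continuous fun t : ℝ => max (|t - s| - d') 0 / max (max (|t - s| - d) 0) (d' - d) :=
    Continuous.div (by fun_prop) (by fun_prop) fun t => (hpos t).ne'
  rw [key, cfc_mul_apply A hc (by fun_prop), hx, map_zero]

theorem norm_sub_le_of_mem_spectralSub {A : H →L[ℂ] H} (hA : IsSelfAdjoint A) {s d : ℝ}
    (hd : 0 < d) {x : H} (hx : x ∈ spectralSub A s d) : ‖A x - (s : ℂ) • x‖ ≤ d * ‖x‖ := by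
  have hpos : ∀ t : ℝ, 0 < max (|t - s|) d := fun t => lt_max_of_lt_right hd
  -- `t - s` is its truncation to `[-d, d]` plus a multiple of `e(t)`
  have key : (fun t : ℝ => t - s) = fun t : ℝ =>
      ((t - s) * (d / max (|t - s|) d)) +
        ((t - s) / max (|t - s|) d) * max (|t - s| - d) 0 := by
    funext t
    have h0 := (hpos t).ne'
    have : max (|t - s| - d) 0 = max (|t - s|) d - d := by
      rw [← max_sub_sub_right, sub_self]
    rw [this]
    field_simp
    ring
  have hc1 : Continuous fun t : ℝ => d / max (|t - s|) d :=
    Continuous.div (by fun_prop) (by fun_prop) fun t => (hpos t).ne'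
  have hc2 : Continuous fun t : ℝ => (t - s) / max (|t - s|) d :=
    Continuous.div (by fun_prop) (by fun_prop) fun t => (hpos t).ne'
  rw [← cfc_sub_const_apply hA, key, cfc_add (a := A) _ _ (by fun_prop) (by fun_prop),
    add_apply, cfc_mul_apply A hc2 (by fun_prop), mem_spectralSub.1 hx,
    map_zero, add_zero]
  refine (ContinuousLinearMap.le_opNorm _ _).trans ?_
  gcongr
  refine norm_cfc_le hd.le fun t _ => ?_
  rw [Real.norm_eq_abs, abs_mul, abs_div, abs_of_pos (hpos t), abs_of_pos hd, mul_div_assoc',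
    div_le_iff₀ (hpos t), mul_comm]
  gcongr
  exact le_max_left _ _

theorem inner_cfc_left {A : H →L[ℂ] H} (f : ℝ → ℝ) (x y : H) :
    inner ℂ (cfc f A x) y = inner ℂ x (cfc f A y) := by
  have h : IsSelfAdjoint (cfc f A) := cfc_predicate f A
  exact (ContinuousLinearMap.isSelfAdjoint_iff_isSymmetric.1 h) x y

/-- Spectral subspaces for disjoint intervals are orthogonal, because the functions `f` and `g`
defining them have no common zero, so that `k * f * f + k * g * g = 1` with a continuous `k`. -/
theorem inner_eq_zero_of_mem_spectralSub {A : H →L[ℂ] H} (hA : IsSelfAdjoint A) {s s' d d' : ℝ}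
    (h : d + d' < |s - s'|) {x y : H} (hx : x ∈ spectralSub A s d)
    (hy : y ∈ spectralSub A s' d') : inner ℂ x y = 0 := by
  set f : ℝ → ℝ := fun t => max (|t - s| - d) 0 with hf
  set g : ℝ → ℝ := fun t => max (|t - s'| - d') 0 with hg
  have hfc : Continuous f := by fun_prop
  have hgc : Continuous g := by fun_prop
  have hpos : ∀ t, 0 < f t * f t + g t * g t := by
    intro t
    by_contra hcon
    have h1 : f t = 0 := by nlinarith [mul_self_nonneg (f t), mul_self_nonneg (g t)]
    have h2 : g t = 0 := by nlinarith [mul_self_nonneg (f t), mul_self_nonneg (g t)]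
    have h3 : |t - s| - d ≤ 0 := h1 ▸ le_max_left _ _
    have h4 : |t - s'| - d' ≤ 0 := h2 ▸ le_max_left _ _
    have h5 : |s - s'| ≤ |t - s| + |t - s'| := by
      have := abs_sub_le s t s'
      rwa [abs_sub_comm s t] at this
    linarith
  set k : ℝ → ℝ := fun t => (f t * f t + g t * g t)⁻¹ with hk
  have hkc : Continuous k := Continuous.inv₀ (by fun_prop) fun t => (hpos t).ne'
  have h1 : cfc (fun t => (k t * f t) * f t + g t * (k t * g t)) A x = x := by
    have : (fun t => (k t * f t) * f t + g t * (k t * g t)) = fun _ => (1 : ℝ) := by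
      funext t
      rw [← inv_mul_cancel₀ (hpos t).ne']
      simp only [hk]
      ring
    rw [this, cfc_const 1 A]; simp
  rw [cfc_add (a := A) _ _ (by fun_prop) (by fun_prop), add_apply,
    cfc_mul_apply A (f := fun t => k t * f t) (by fun_prop) hfc, mem_spectralSub.1 hx, map_zero,
    zero_add, cfc_mul_apply A hgc (by fun_prop)] at h1
  rw [← h1, inner_cfc_left, mem_spectralSub.1 hy, inner_zero_right]

/-- All spectral neighbourhoods of a point of the essential spectrum are infinite dimensional. If
one of them were finite dimensional, then the truncated inverse
`t ↦ (t - s) / max ((t - s) ^ 2) (d ^ 2)` of `t - s` would give a quasi-inverse of `A - s`. -/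
theorem not_finite_spectralSub_of_mem_essentialSpectrum {A : H →L[ℂ] H} (hA : IsSelfAdjoint A)
    {s d : ℝ} (hs : (s : ℂ) ∈ essentialSpectrum A) (hd : 0 < d) :
    ¬ FiniteDimensional ℂ (spectralSub A s d) := by
  intro hfin
  refine hs ?_
  have hpos : ∀ t : ℝ, 0 < max ((t - s) ^ 2) (d ^ 2) := fun t => lt_max_of_lt_right (by positivity)
  set m : ℝ → ℝ := fun t => (t - s) / max ((t - s) ^ 2) (d ^ 2) with hm
  have hmc : Continuous m := Continuous.div (by fun_prop) (by fun_prop) fun t => (hpos t).ne'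
  have hB : ∀ x, ((s : ℂ) • ContinuousLinearMap.id ℂ H - A) x = - cfc (fun t : ℝ => t - s) A x := by
    intro x; rw [cfc_sub_const_apply hA]; simp
  have hzero : ∀ t, max (|t - s| - d) 0 * (1 - m t * (t - s)) = 0 := by
    intro t
    rcases le_or_gt (|t - s|) d with h1 | h1
    · rw [max_eq_right (by linarith), zero_mul]
    · have h2 : d ^ 2 ≤ (t - s) ^ 2 := by
        rw [← sq_abs (t - s)]; gcongr
      have h3 : 0 < (t - s) ^ 2 := by have : 0 < d ^ 2 := by positivity
                                      linarith
      simp only [hm]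
      rw [max_eq_left h2, div_mul_eq_mul_div, ← sq, div_self h3.ne', sub_self, mul_zero]
  have hmem : ∀ x, x - cfc m A (cfc (fun t : ℝ => t - s) A x) ∈ spectralSub A s d := by
    intro x
    have : x - cfc m A (cfc (fun t : ℝ => t - s) A x) =
        cfc (fun t => 1 - m t * (t - s)) A x := by
      rw [cfc_sub (a := A) (fun _ => 1) (fun t => m t * (t - s)) (by fun_prop) (by fun_prop),
        cfc_const 1 A, sub_apply, cfc_mul_apply A hmc (by fun_prop)]
      simp
    rw [this, mem_spectralSub, ← cfc_mul_apply A (by fun_prop) (by fun_prop)]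
    simp only [hzero]
    rw [cfc_const 0 A]; simp
  have hcomm : ∀ x, cfc (fun t : ℝ => t - s) A (cfc m A x) =
      cfc m A (cfc (fun t : ℝ => t - s) A x) := fun x => by
      rw [← cfc_mul_apply A hmc (by fun_prop), ← cfc_mul_apply A (by fun_prop) hmc]
      simp only [mul_comm]
  have hrange : ∀ R : H →ₗ[ℂ] H, (∀ x, -R x ∈ spectralSub A s d) → R.HasFiniteRange := by
    intro R hR
    rw [LinearMap.hasFiniteRange_iff_range, Submodule.fg_iff_finiteDimensional]
    refine Submodule.finiteDimensional_of_le (S₂ := spectralSub A s d) ?_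
    rintro _ ⟨x, rfl⟩
    simpa using neg_mem (hR x)
  refine ContinuousLinearMap.IsFredholm.of_isQuasiInverse (v := - cfc m A)
    ⟨LinearMap.FiniteRangeSetoid.equiv_iff_hasFiniteRange.2 (hrange _ fun x => ?_),
      LinearMap.FiniteRangeSetoid.equiv_iff_hasFiniteRange.2 (hrange _ fun x => ?_)⟩
  · have h := hmem x
    have h1 := hB x
    simp only [LinearMap.sub_apply, LinearMap.comp_apply, ContinuousLinearMap.coe_coe,
      LinearMap.id_apply, h1, neg_apply, map_neg, neg_neg, neg_sub]
    exact h
  · have h := hmem x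
    have h1 := hB (cfc m A x)
    simp only [LinearMap.sub_apply, LinearMap.comp_apply, ContinuousLinearMap.coe_coe,
      LinearMap.id_apply, neg_apply, map_neg, neg_sub, h1, neg_neg, hcomm]
    exact h

/-- A quasi-inverse `v` of `A - s` forces a small spectral neighbourhood of `s` to be finite
dimensional: if `d * ‖v‖ < 1`, then `v (A - s) - 1`, which has finite rank, is injective on it. -/
theorem mem_essentialSpectrum_of_not_finite_spectralSub {A : H →L[ℂ] H} (hA : IsSelfAdjoint A)
    {s : ℝ} (hs : ∀ d > 0, ¬ FiniteDimensional ℂ (spectralSub A s d)) :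
    (s : ℂ) ∈ essentialSpectrum A := by
  intro hF
  obtain ⟨v, hv, -⟩ := hF.exists_isQuasiInverse
  have hfin := LinearMap.FiniteRangeSetoid.equiv_iff_hasFiniteRange.1 hv
  rw [LinearMap.hasFiniteRange_iff_range, Submodule.fg_iff_finiteDimensional] at hfin
  set R := (v : H →ₗ[ℂ] H) ∘ₗ (((s : ℂ) • ContinuousLinearMap.id ℂ H - A : H →L[ℂ] H) : H →ₗ[ℂ] H)
    - LinearMap.id with hR
  have hd : 0 < (‖v‖ + 1)⁻¹ := by positivity
  refine hs _ hd ?_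
  set N := spectralSub A s (‖v‖ + 1)⁻¹ with hN
  have hinj : Function.Injective (R.rangeRestrict ∘ₗ N.subtype) := by
    rw [← LinearMap.ker_eq_bot, LinearMap.ker_eq_bot']
    intro x hx
    have h1 : R x = 0 := congrArg Subtype.val hx
    have h2 := norm_sub_le_of_mem_spectralSub hA hd x.2
    have h3 : (x : H) = v ((s : ℂ) • (x : H) - A x) := by
      simp only [hR, LinearMap.sub_apply, LinearMap.comp_apply, ContinuousLinearMap.coe_coe,
        LinearMap.id_apply, sub_eq_zero] at h1
      exact h1.symm
    have h4 : ‖(x : H)‖ ≤ ‖v‖ * ((‖v‖ + 1)⁻¹ * ‖(x : H)‖) := by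
      calc ‖(x : H)‖ = ‖v ((s : ℂ) • (x : H) - A x)‖ := by rw [← h3]
        _ ≤ ‖v‖ * ‖(s : ℂ) • (x : H) - A x‖ := v.le_opNorm _
        _ ≤ _ := by rw [norm_sub_rev]; gcongr
    have h5 : ‖v‖ * (‖v‖ + 1)⁻¹ < 1 := by
      rw [← div_eq_mul_inv, div_lt_one (by positivity)]; linarith
    have h6 : ‖(x : H)‖ = 0 := by nlinarith [norm_nonneg (x : H)]
    exact Subtype.ext (norm_eq_zero.1 h6)
  exact FiniteDimensional.of_injective _ hinj

/-- An invariant subspace of a self-adjoint operator is reducing. -/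
theorem commute_starProjection {A : H →L[ℂ] H} (hA : IsSelfAdjoint A) {D : Submodule ℂ H}
    [D.HasOrthogonalProjection] (hDinv : ∀ x ∈ D, A x ∈ D) : Commute A D.starProjection := by
  refine ContinuousLinearMap.ext fun x => ?_
  refine (Submodule.eq_starProjection_of_mem_orthogonal (u := A x) (v := A (D.starProjection x))
    (hDinv _ (D.starProjection_apply_mem x)) ?_).symm
  rw [← map_sub]
  intro y hy
  have hs : inner ℂ (A y) (x - D.starProjection x) = inner ℂ y (A (x - D.starProjection x)) :=
    (ContinuousLinearMap.isSelfAdjoint_iff_isSymmetric.1 hA) y _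
  rw [← hs]
  exact D.sub_starProjection_mem_orthogonal x _ (hDinv y hy)

theorem cfc_mem_of_invariant {A : H →L[ℂ] H} (hA : IsSelfAdjoint A) {D : Submodule ℂ H}
    (hDc : IsClosed (D : Set H)) (hDinv : ∀ x ∈ D, A x ∈ D) (f : ℝ → ℝ) {x : H} (hx : x ∈ D) :
    cfc f A x ∈ D := by
  have : CompleteSpace D := hDc.completeSpace_coe
  have h := ((commute_starProjection hA hDinv).cfc_real f).eq
  have h1 : cfc f A (D.starProjection x) = D.starProjection (cfc f A x) :=
    congrArg (fun T : H →L[ℂ] H => T x) h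
  rw [Submodule.starProjection_eq_self_iff.2 hx] at h1
  exact Submodule.starProjection_eq_self_iff.1 h1.symm

omit [CompleteSpace H] in
theorem finite_ker_mul_inf {S T : H →L[ℂ] H} {D : Submodule ℂ H} (hT : ∀ x ∈ D, T x ∈ D)
    (hS : FiniteDimensional ℂ ↥(S.ker ⊓ D)) (hTf : FiniteDimensional ℂ ↥(T.ker ⊓ D)) :
    FiniteDimensional ℂ ↥((S * T).ker ⊓ D) := by
  rw [← Submodule.fg_iff_finiteDimensional]
  refine Submodule.fg_of_fg_map_of_fg_inf_ker (T : H →ₗ[ℂ] H) ?_ ?_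
  · rw [Submodule.fg_iff_finiteDimensional]
    refine Submodule.finiteDimensional_of_le (S₂ := S.ker ⊓ D) ?_
    rintro _ ⟨x, ⟨hx, hxD⟩, rfl⟩
    exact ⟨hx, hT x hxD⟩
  · rw [Submodule.fg_iff_finiteDimensional]
    refine Submodule.finiteDimensional_of_le (S₂ := T.ker ⊓ D) ?_
    rintro x ⟨⟨-, hxD⟩, hx⟩
    exact ⟨hx, hxD⟩

/-- Every infinite-dimensional reducing subspace carries a point all of whose spectral
neighbourhoods are infinite dimensional: otherwise finitely many spectral subspaces with
finite-dimensional traces on `D` cover the spectrum, and the product of the corresponding functions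
of `A` is zero although its kernel on `D` is finite dimensional. -/
theorem exists_not_finite_spectralSub_inf {A : H →L[ℂ] H} (hA : IsSelfAdjoint A)
    {D : Submodule ℂ H} (hDc : IsClosed (D : Set H)) (hDinv : ∀ x ∈ D, A x ∈ D)
    (hD : ¬ FiniteDimensional ℂ D) :
    ∃ s : ℝ, ∀ d > 0, ¬ FiniteDimensional ℂ ↥(spectralSub A s d ⊓ D) := by
  by_contra! hcon
  choose δ hδ hfin using hcon
  have hcomp : IsCompact (spectrum ℝ A) := ContinuousFunctionalCalculus.isCompact_spectrum A
  obtain ⟨F, -, hF⟩ := hcomp.elim_nhds_subcover (fun s => Metric.ball s (δ s))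
    fun s _ => Metric.ball_mem_nhds s (hδ s)
  have hprod : ∀ F : Finset ℝ, FiniteDimensional ℂ
      ↥((cfc (fun t : ℝ => ∏ s ∈ F, max (|t - s| - δ s) 0) A).ker ⊓ D) := by
    intro F
    induction F using Finset.induction_on with
    | empty =>
      have h1 : cfc (fun t : ℝ => ∏ s ∈ (∅ : Finset ℝ), max (|t - s| - δ s) 0) A = 1 := by
        simp only [Finset.prod_empty]
        exact cfc_const_one ℝ A
      rw [h1]
      exact Submodule.finiteDimensional_of_le (S₂ := (⊥ : Submodule ℂ H)) fun x hx => hx.1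
    | insert s F hs ih =>
      have h1 : cfc (fun t : ℝ => ∏ s ∈ insert s F, max (|t - s| - δ s) 0) A =
          cfc (fun t : ℝ => max (|t - s| - δ s) 0) A *
            cfc (fun t : ℝ => ∏ s ∈ F, max (|t - s| - δ s) 0) A := by
        simp only [Finset.prod_insert hs]
        exact cfc_mul (a := A) _ _ (by fun_prop) (by fun_prop)
      rw [h1]
      exact finite_ker_mul_inf (fun x hx => cfc_mem_of_invariant hA hDc hDinv _ hx) (hfin s) ih
  refine hD ?_
  have h0 : cfc (fun t : ℝ => ∏ s ∈ F, max (|t - s| - δ s) 0) A = 0 := by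
    rw [← cfc_const_zero ℝ A]
    refine cfc_congr fun t ht => ?_
    obtain ⟨s, hs, hts⟩ := Set.mem_iUnion₂.1 (hF ht)
    rw [Metric.mem_ball, Real.dist_eq] at hts
    exact Finset.prod_eq_zero hs (max_eq_right (by linarith))
  have := hprod F
  rw [h0] at this
  exact Submodule.finiteDimensional_of_le (S₂ := (0 : H →L[ℂ] H).ker ⊓ D) fun x hx => ⟨rfl, hx⟩

omit [CompleteSpace H] in
theorem HilbertBasis.infinite_index {ι : Type*} (b : HilbertBasis ι ℂ H)
    (hH : ¬ FiniteDimensional ℂ H) : Infinite ι := by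
  by_contra hfin
  rw [not_infinite_iff_finite] at hfin
  have := Fintype.ofFinite ι
  exact hH (b.toOrthonormalBasis.toBasis.finiteDimensional_of_finite)

theorem exists_orthonormal_seq {V : Submodule ℂ H} (hVc : IsClosed (V : Set H))
    (hV : ¬ FiniteDimensional ℂ V) : ∃ b : ℕ → H, Orthonormal ℂ b ∧ ∀ i, b i ∈ V := by
  have : CompleteSpace V := hVc.completeSpace_coe
  obtain ⟨w, b, -⟩ := exists_hilbertBasis ℂ V
  have := b.infinite_index hV
  exact ⟨fun i => b (Infinite.natEmbedding w i),
    (b.orthonormal.comp _ (Infinite.natEmbedding w).injective).comp_linearIsometry V.subtypeₗᵢ,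
    fun i => (b _).2⟩

/-- If all spectral neighbourhoods of `s` are infinite dimensional on `D`, then `D` contains a
sequence of mutually orthogonal invariant subspaces on which `A` is closer and closer to `s`. -/
theorem exists_orthogonal_seq_spectralSub {A : H →L[ℂ] H} (hA : IsSelfAdjoint A)
    {D : Submodule ℂ H} (hDc : IsClosed (D : Set H)) (hDinv : ∀ x ∈ D, A x ∈ D) {s : ℝ}
    (hs : ∀ d > 0, ¬ FiniteDimensional ℂ ↥(spectralSub A s d ⊓ D)) :
    ∃ X : ℕ → Submodule ℂ H, (∀ i, X i ≠ ⊥) ∧ (∀ i j, i ≠ j → X i ⟂ X j) ∧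
      (∀ i, ∀ x ∈ X i, A x ∈ X i) ∧ (∀ i, X i ≤ D) ∧
      ∀ d > 0, ∀ᶠ i in cofinite, X i ≤ spectralSub A s d := by
  set V : ℕ → Submodule ℂ H := fun n => spectralSub A s (1 / ((n : ℝ) + 1)) ⊓ D with hV
  have hVanti : Antitone V := fun m n hmn => inf_le_inf_right _
    (spectralSub_mono A s (one_div_le_one_div_of_le (by positivity)
      (by exact_mod_cast Nat.succ_le_succ hmn)))
  have hVc : ∀ n, IsClosed (V n : Set H) := fun n => (isClosed_spectralSub A s _).inter hDc
  have hVinv : ∀ n, ∀ x ∈ V n, A x ∈ V n := fun n x hx =>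
    ⟨map_mem_spectralSub s _ (Commute.refl A) hx.1, hDinv x hx.2⟩
  have hVle : ∀ d > 0, ∃ n, V n ≤ spectralSub A s d := fun d hd => by
    obtain ⟨n, hn⟩ := exists_nat_one_div_lt hd
    exact ⟨n, inf_le_left.trans (spectralSub_mono A s hn.le)⟩
  by_cases hstab : ∃ n, ∀ m ≥ n, V m = V n
  · -- the spectral subspaces stabilise at an infinite-dimensional eigenspace
    obtain ⟨n, hn⟩ := hstab
    have hle : ∀ d > 0, V n ≤ spectralSub A s d := fun d hd => by
      obtain ⟨m, hm⟩ := hVle d hd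
      rw [← hn (max m n) (le_max_right _ _)]
      exact (hVanti (le_max_left m n)).trans hm
    have heig : ∀ x ∈ V n, A x = (s : ℂ) • x := fun x hx => by
      rw [← sub_eq_zero, ← norm_le_zero_iff]
      refine le_of_forall_pos_le_add fun ε hε => ?_
      have h1 : 0 < ε / (‖x‖ + 1) := by positivity
      refine (norm_sub_le_of_mem_spectralSub hA h1 (hle _ h1 hx)).trans ?_
      rw [div_mul_eq_mul_div, zero_add, div_le_iff₀ (by positivity)]
      nlinarith [norm_nonneg x]
    have hinf : ¬ FiniteDimensional ℂ (V n) := hs _ (by positivity)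
    obtain ⟨b, hb, hbV⟩ := exists_orthonormal_seq (hVc n) hinf
    refine ⟨fun i => ℂ ∙ b i, fun i => ?_, fun i j hij => ?_, fun i x hx => ?_, fun i => ?_,
      fun d hd => Eventually.of_forall fun i => ?_⟩
    · simpa using hb.ne_zero i
    · rw [Submodule.isOrtho_span]
      rintro _ rfl _ rfl
      exact hb.2 hij
    · have : x ∈ V n := (Submodule.span_singleton_le_iff_mem _ _).2 (hbV i) hx
      rw [heig x this]
      exact Submodule.smul_mem _ _ hx
    · exact (Submodule.span_singleton_le_iff_mem _ _).2 (hbV i).2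
    · exact (Submodule.span_singleton_le_iff_mem _ _).2 (hle d hd (hbV i))
  · -- otherwise a subsequence decreases strictly, and its successive orthogonal differences do
    push Not at hstab
    have hlt : ∀ n, ∃ m > n, V m < V n := fun n => by
      obtain ⟨m, hm, hne⟩ := hstab n
      exact ⟨m, lt_of_le_of_ne hm fun h => hne (h ▸ rfl), lt_of_le_of_ne (hVanti hm) hne⟩
    choose g hg hgV using hlt
    set φ : ℕ → ℕ := fun i => g^[i] 0 with hφ
    have hφs : ∀ i, φ (i + 1) = g (φ i) := fun i => Function.iterate_succ_apply' g i 0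
    have hφm : StrictMono φ := strictMono_nat_of_lt_succ fun i => by rw [hφs]; exact hg _
    refine ⟨fun i => V (φ i) ⊓ (V (φ (i + 1)))ᗮ, fun i hbot => ?_, ?_,
      fun i x hx => ⟨hVinv _ x hx.1, ?_⟩,
      fun i => inf_le_left.trans inf_le_right, fun d hd => ?_⟩
    · have : CompleteSpace (V (φ (i + 1))) := (hVc _).completeSpace_coe
      have := Submodule.sup_orthogonal_inf_of_hasOrthogonalProjection
        (hVanti (hφm (Nat.lt_succ_self i)).le)
      rw [inf_comm, show V (φ i) ⊓ (V (φ (i + 1)))ᗮ = ⊥ from hbot, sup_bot_eq] at this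
      have h2 := hgV (φ i)
      rw [← hφs, this] at h2
      exact lt_irrefl _ h2
    · have key : ∀ i j, i < j → (V (φ i) ⊓ (V (φ (i + 1)))ᗮ) ⟂ (V (φ j) ⊓ (V (φ (j + 1)))ᗮ) :=
        fun i j hij => by
        refine Submodule.IsOrtho.mono inf_le_right
          (inf_le_left.trans (hVanti (hφm.monotone (Nat.succ_le_of_lt hij)))) ?_
        exact Submodule.isOrtho_orthogonal_left _
      intro i j hij
      rcases lt_or_gt_of_ne hij with h | h
      · exact key i j h
      · exact (key j i h).symm
    · intro y hy
      have hs : inner ℂ (A y) x = inner ℂ y (A x) :=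
        (ContinuousLinearMap.isSelfAdjoint_iff_isSymmetric.1 hA) y x
      rw [← hs]
      exact hx.2 _ (hVinv _ y hy)
    · obtain ⟨n, hn⟩ := hVle d hd
      rw [Nat.cofinite_eq_atTop]
      filter_upwards [eventually_ge_atTop n] with i hi
      exact inf_le_left.trans ((hVanti (hi.trans (hφm.id_le i))).trans hn)

end SpectralSubspaces

/-! ### Permutations of an orthonormal basis are unitary spreads -/

/-- An injective sequence of natural numbers splits into infinitely many infinite increasing pieces.
The records of the sequence (the terms exceeding all earlier ones) are distributed infinitely often
over all colours, and a term that is no record gets its own index as colour. The `k`-th record has a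
colour at most `k`, hence at most its index, so that it cannot precede a non-record of the same
colour. -/
theorem exists_infinite_monotone_coloring {π : ℕ → ℕ} (hπ : Function.Injective π) :
    ∃ c : ℕ → ℕ, (∀ j, {n | c n = j}.Infinite) ∧ ∀ m n, c m = c n → m < n → π m < π n := by
  classical
  set R : ℕ → Prop := fun n => ∀ m < n, π m < π n with hR
  have hRinf : (Set.ofPred R).Infinite := by
    rw [Set.infinite_iff_exists_gt]
    intro N
    obtain ⟨M, hM⟩ : ∃ M, ∀ n ≤ N, π n ≤ M :=
      ⟨∑ i ∈ Finset.range (N + 1), π i, fun n hn =>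
        Finset.single_le_sum (f := π) (fun _ _ => Nat.zero_le _)
          (Finset.mem_range.2 (Nat.lt_succ_of_le hn))⟩
    have hex : ∃ n, M < π n := by
      by_contra! hcon
      exact Set.infinite_range_of_injective hπ
        ((Set.finite_Iic M).subset (Set.range_subset_iff.2 hcon))
    refine ⟨Nat.find hex, fun m hm => ?_, ?_⟩
    · exact (not_lt.1 (Nat.find_min hex hm)).trans_lt (Nat.find_spec hex)
    · by_contra! hle
      exact absurd (Nat.find_spec hex) (not_lt.2 (hM _ hle))
  refine ⟨fun n => if R n then (Nat.unpair (Nat.count R n)).1 else n, fun j => ?_,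
    fun m n hmn hlt => ?_⟩
  · refine Set.infinite_of_injective_forall_mem (f := fun k => Nat.nth R (Nat.pair j k)) ?_ ?_
    · intro k l hkl
      have := Nat.nth_injective hRinf hkl
      simpa using this
    · intro k
      have h1 : R (Nat.nth R (Nat.pair j k)) := Nat.nth_mem_of_infinite hRinf _
      simp only [Set.mem_ofPred_eq, if_pos h1, Nat.count_nth_of_infinite hRinf, Nat.unpair_pair]
  · by_cases hn : R n
    · exact hn m hlt
    · simp only [if_neg hn] at hmn
      split_ifs at hmn with hm
      · -- an earlier record of the colour `n` would satisfy `n ≤ m`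
        have := (Nat.unpair_left_le (Nat.count R m)).trans (Nat.count_le (p := R))
        omega
      · omega

section
variable {H : Type u} [NormedAddCommGroup H] [InnerProductSpace ℂ H]

/-- Reindexing of a Hilbert basis along an equivalence. -/
noncomputable def HilbertBasis.reindexEquiv [CompleteSpace H] {ι κ : Type*}
    (b : HilbertBasis ι ℂ H) (e : κ ≃ ι) : HilbertBasis κ ℂ H :=
  HilbertBasis.mk (v := b ∘ e) (b.orthonormal.comp e e.injective) (by
    rw [e.surjective.range_comp]; exact b.dense_span.ge)

theorem HilbertBasis.reindexEquiv_apply [CompleteSpace H] {ι κ : Type*} (b : HilbertBasis ι ℂ H)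
    (e : κ ≃ ι) (k : κ) : b.reindexEquiv e k = b (e k) := by
  simp [HilbertBasis.reindexEquiv]

/-- A Hilbert basis from an orthonormal family to which no nonzero vector is orthogonal. -/
theorem Orthonormal.exists_hilbertBasis_of_total [CompleteSpace H] {ι : Type*} {v : ι → H}
    (hv : Orthonormal ℂ v) (h : ∀ x, (∀ i, inner ℂ (v i) x = 0) → x = 0) :
    ∃ b : HilbertBasis ι ℂ H, ⇑b = v := by
  refine ⟨HilbertBasis.mkOfOrthogonalEqBot hv ?_, HilbertBasis.coe_mkOfOrthogonalEqBot hv _⟩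
  rw [Submodule.eq_bot_iff]
  exact fun x hx => h x fun i => hx _ (Submodule.subset_span ⟨i, rfl⟩)

theorem HilbertBasis.eq_zero_of_inner {ι : Type*} (b : HilbertBasis ι ℂ H) {x : H}
    (h : ∀ i, inner ℂ (b i) x = 0) : x = 0 := by
  have := b.hasSum_repr x
  simp only [b.repr_apply_apply, h, zero_smul] at this
  exact this.unique hasSum_zero

theorem HilbertBasis.inner_eq_zero {ι : Type*} (b : HilbertBasis ι ℂ H) {x y : H}
    (h : ∀ i, inner ℂ x (b i) = 0 ∨ inner ℂ (b i) y = 0) : inner ℂ x y = 0 := by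
  have := b.hasSum_inner_mul_inner x y
  have h0 : (fun i => inner ℂ x (b i) * inner ℂ (b i) y) = fun _ => 0 := by
    funext i
    rcases h i with h | h <;> simp [h]
  rw [h0] at this
  exact this.unique hasSum_zero

variable [CompleteSpace H]

/-- A unitary operator permuting an orthonormal basis is a unitary spread: the permutation splits
into infinitely many increasing injections between infinite sets. -/
theorem isUnitarySpread_of_perm_nat (e : HilbertBasis ℕ ℂ H) (π : Equiv.Perm ℕ) (U : H ≃ₗᵢ[ℂ] H)
    (hU : ∀ n, U (e n) = e (π n)) : IsUnitarySpread (U : H →L[ℂ] H) := by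
  obtain ⟨c, hc, hmono⟩ := exists_infinite_monotone_coloring π.injective
  refine ⟨?_, e, fun j => {n | c n = j}, fun j => π '' {n | c n = j}, ?_⟩
  · rw [← Unitary.coe_symm_linearIsometryEquiv_apply]
    exact (Unitary.linearIsometryEquiv.symm U).2
  -- the spread belonging to a colour is `U` after the projection onto its basis vectors
  set K : ℕ → Submodule ℂ H := fun j => (Submodule.span ℂ (e '' {n | c n = j})).topologicalClosure
    with hK
  have hcompl : ∀ j, CompleteSpace (K j) := fun j =>
    (Submodule.isClosed_topologicalClosure _).completeSpace_coe
  have hPmem : ∀ n, (K (c n)).starProjection (e n) = e n := fun n =>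
    Submodule.starProjection_eq_self_iff.2
      (Submodule.le_topologicalClosure _ (Submodule.subset_span ⟨n, rfl, rfl⟩))
  have hPne : ∀ j n, c n ≠ j → (K j).starProjection (e n) = 0 := fun j n hn => by
    rw [Submodule.starProjection_apply_eq_zero_iff, hK, Submodule.orthogonal_closure]
    intro y hy
    refine Submodule.span_induction (p := fun y _ => inner ℂ y (e n) = 0) ?_ (by simp) ?_ ?_ hy
    · rintro _ ⟨m, hm, rfl⟩
      exact e.orthonormal.2 fun h => hn (h ▸ hm)
    · intro x y _ _ hx hy
      rw [inner_add_left, hx, hy, add_zero]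
    · intro a x _ hx
      rw [inner_smul_left, hx, mul_zero]
  refine ⟨fun j => (U : H →L[ℂ] H) ∘L (K j).starProjection, fun j => ⟨hc j,
    (hc j).image π.injective.injOn, fun n hn => ?_, fun k => ?_⟩, fun x => ?_⟩
  · simp [hPne j n hn]
  · have hB : c (Nat.nth (fun n => c n = j) k) = j := Nat.nth_mem_of_infinite (hc j) k
    have h1 : Nat.nth (fun n => n ∈ π '' {n | c n = j}) k = π (Nat.nth (fun n => c n = j) k) := by
      refine (Nat.eq_nth_of_strictMonoOn_of_mapsTo_of_surjOn
        (fun k => π (Nat.nth (fun n => c n = j) k)) ?_ ?_ ?_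
        (show k ∈ _ from fun hf => absurd hf ((hc j).image π.injective.injOn))).symm
      · rintro _ ⟨n, hn, rfl⟩
        exact ⟨Nat.count (fun n => c n = j) n,
          fun hf => absurd hf ((hc j).image π.injective.injOn),
          congrArg π (Nat.nth_count (p := fun n => c n = j) hn)⟩
      · exact fun k _ => ⟨_, Nat.nth_mem_of_infinite (hc j) k, rfl⟩
      · intro k _ l _ hkl
        refine hmono _ _ ?_ (Nat.nth_strictMono (hc j) hkl)
        rw [Nat.nth_mem_of_infinite (hc j) k, Nat.nth_mem_of_infinite (hc j) l]
    have h2 := hPmem (Nat.nth (fun n => c n = j) k)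
    rw [hB] at h2
    rw [h1]
    change U ((K j).starProjection (e (Nat.nth (fun n => c n = j) k))) = _
    rw [h2, hU]
  · have h1 := (e.hasSum_repr x)
    have h2 : HasSum (fun j => (K j).starProjection x) x := by
      refine ((Equiv.sigmaFiberEquiv c).hasSum_iff.2 h1).sigma fun j => ?_
      have h3 := h1.mapL (K j).starProjection
      rw [← hasSum_subtype_iff_of_support_subset (s := {n | c n = j})] at h3
      · have h4 : ∀ n : {n | c n = j},
            (K j).starProjection (e.repr x n • e n) = e.repr x n • e n := by
          intro n
          have := hPmem n
          rw [n.2] at this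
          rw [map_smul, this]
        exact (congrArg (fun f => HasSum f ((K j).starProjection x)) (funext h4)).mp h3
      · intro n hn
        by_contra h
        simp [hPne j n h] at hn
    have h4 := (h2.mapL (U : H →L[ℂ] H)).tendsto_sum_nat
    simpa using h4

theorem isUnitarySpread_of_perm {ι : Type*} [Countable ι] [Infinite ι] (b : HilbertBasis ι ℂ H)
    (σ : Equiv.Perm ι) (U : H ≃ₗᵢ[ℂ] H) (hU : ∀ i, U (b i) = b (σ i)) :
    IsUnitarySpread (U : H →L[ℂ] H) := by
  obtain ⟨_⟩ := nonempty_denumerable ι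
  set f : ℕ ≃ ι := (Denumerable.eqv ι).symm
  refine isUnitarySpread_of_perm_nat (b.reindexEquiv f) ((f.trans σ).trans f.symm) U fun n => ?_
  simp [HilbertBasis.reindexEquiv_apply, hU]

/-- If `U` maps the basis `S` to the shift of the basis `T`, and for every `n` the vectors
`S (n, ·)` are orthogonal to all `T (m, ·)` with `m ≠ n`, then `U` is a bilateral shift, which
permutes the basis `U ^ n (T (0, c))`. -/
theorem exists_unitarySpread_of_shift {C : Type*} [Countable C] [Nonempty C]
    (T S : HilbertBasis (ℤ × C) ℂ H)
    (hST : ∀ n m c c', n ≠ m → inner ℂ (T (m, c')) (S (n, c)) = 0) :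
    ∃ U : H ≃ₗᵢ[ℂ] H, IsUnitarySpread (U : H →L[ℂ] H) ∧ ∀ n c, U (S (n, c)) = T (n + 1, c) := by
  set T' := T.reindexEquiv ((Equiv.addRight (1 : ℤ)).prodCongr (Equiv.refl C)) with hT'
  have hT'a : ∀ n c, T' (n, c) = T (n + 1, c) := fun n c => by
    rw [hT', HilbertBasis.reindexEquiv_apply]; rfl
  set U : H ≃ₗᵢ[ℂ] H := S.repr.trans T'.repr.symm with hUdef
  have hU : ∀ n c, U (S (n, c)) = T (n + 1, c) := fun n c => by
    classical
    rw [← hT'a, hUdef, LinearIsometryEquiv.trans_apply, S.repr_self, T'.repr_symm_single]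
  refine ⟨U, ?_, hU⟩
  -- `W n` is the closed span of the vectors `T (n, ·)`, and `U` maps `W n` onto `W (n + 1)`
  set W : ℤ → Set H := fun n => {x | ∀ m c, m ≠ n → inner ℂ (T (m, c)) x = 0} with hW
  have hTW : ∀ n c, T (n, c) ∈ W n := fun n c m c' hm => T.orthonormal.2 (by simp [hm])
  have hSW : ∀ n c, S (n, c) ∈ W n := fun n c m c' hm => hST n m c c' hm.symm
  have hWW : ∀ {n m x y}, n ≠ m → x ∈ W n → y ∈ W m → inner ℂ x y = 0 := by
    intro n m x y hnm hx hy
    refine T.inner_eq_zero fun ⟨k, c⟩ => ?_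
    by_cases hk : k = n
    · exact Or.inr (hy k c (hk ▸ hnm))
    · exact Or.inl (inner_eq_zero_symm.1 (hx k c hk))
  have hUW : ∀ n x, x ∈ W n → U x ∈ W (n + 1) := by
    intro n x hx m c hm
    have : T (m, c) = U (S (m - 1, c)) := by rw [hU]; simp
    rw [this, U.inner_map_map]
    exact hWW (by omega) (hSW _ _) hx
  have hUW' : ∀ n x, x ∈ W (n + 1) → U.symm x ∈ W n := by
    intro n x hx m c hm
    rw [← U.inner_map_map, U.apply_symm_apply]
    exact hWW (by omega) (hUW _ _ (hTW m c)) hx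
  have hpow : ∀ (k n : ℤ) x, x ∈ W n → (U ^ k) x ∈ W (n + k) := by
    intro k
    induction k using Int.induction_on with
    | zero => intro n x hx; simpa using hx
    | succ k ih =>
      intro n x hx
      have := hUW _ _ (ih n x hx)
      rw [add_comm (k : ℤ) 1, zpow_add, zpow_one, ← add_assoc, add_right_comm]
      exact this
    | pred k ih =>
      intro n x hx
      have h1 := ih n x hx
      rw [show n + -(k : ℤ) = (n + (-(k : ℤ) - 1)) + 1 by ring] at h1
      have := hUW' _ _ h1
      rw [show (-(k : ℤ) - 1) = -1 + -k by ring, zpow_add, zpow_neg_one]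
      rw [show n + (-1 + -(k : ℤ)) = n + (-(k : ℤ) - 1) by ring]
      exact this
  have horth : Orthonormal ℂ fun i : ℤ × C => (U ^ i.1) (T (0, i.2)) := by
    constructor
    · intro i
      rw [LinearIsometryEquiv.norm_map]
      exact T.orthonormal.1 _
    · rintro ⟨n, c⟩ ⟨m, c'⟩ hne
      by_cases hnm : n = m
      · subst hnm
        simp only [LinearIsometryEquiv.inner_map_map]
        exact T.orthonormal.2 fun h => hne (by simpa using h)
      · have h1 := hpow n 0 _ (hTW 0 c)
        have h2 := hpow m 0 _ (hTW 0 c')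
        exact hWW (by omega) h1 h2
  obtain ⟨b, hb⟩ := horth.exists_hilbertBasis_of_total (fun x hx => by
    refine T.eq_zero_of_inner fun ⟨n, c⟩ => ?_
    have h1 := hpow (-n) n _ (hTW n c)
    rw [add_neg_cancel] at h1
    rw [← (U ^ (-n)).inner_map_map]
    refine T.inner_eq_zero fun ⟨k, c'⟩ => ?_
    by_cases hk : k = 0
    · right
      subst hk
      have h2 := hx (n, c')
      rw [← (U ^ (-n)).inner_map_map, show (U ^ (-n)) ((U ^ n) (T (0, c'))) =
          (U ^ (-n) * U ^ n) (T (0, c')) from rfl, ← zpow_add] at h2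
      simpa using h2
    · exact Or.inl (inner_eq_zero_symm.1 (h1 k c' hk)))
  refine isUnitarySpread_of_perm b ((Equiv.addRight (1 : ℤ)).prodCongr (Equiv.refl C)) U
    fun ⟨n, c⟩ => ?_
  rw [hb]
  change U ((U ^ n) (T (0, c))) = (U ^ (n + 1)) (T (0, c))
  rw [add_comm, zpow_add, zpow_one]
  rfl
end

/-! ### Shift models and their eigenvalues -/

section Sequences

theorem not_tendsto_zero_of_eventually_le_succ {f : ℤ → ℝ} (hf : ∀ n, 0 < f n)
    (h0 : Tendsto f cofinite (𝓝 0)) (h : ∀ᶠ n in atTop, f n ≤ f (n + 1)) : False := by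
  obtain ⟨N, hN⟩ := eventually_atTop.1 h
  have hmono : ∀ n, N ≤ n → f N ≤ f n := fun n hn => by
    induction n, hn using Int.leInduction with
    | base => exact le_rfl
    | succ n hn ih => exact ih.trans (hN n hn)
  rw [Int.cofinite_eq] at h0
  have := ge_of_tendsto (h0.mono_left le_sup_right) (eventually_atTop.2 ⟨N, hmono⟩)
  exact absurd (hf N) (not_lt.2 this)

theorem not_tendsto_zero_of_eventually_succ_le {f : ℤ → ℝ} (hf : ∀ n, 0 < f n)
    (h0 : Tendsto f cofinite (𝓝 0)) (h : ∀ᶠ n in atBot, f (n + 1) ≤ f n) : False := by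
  refine not_tendsto_zero_of_eventually_le_succ (f := fun n => f (-n)) (fun n => hf _)
    (h0.comp (neg_injective.tendsto_cofinite)) ?_
  obtain ⟨N, hN⟩ := eventually_atBot.1 h
  filter_upwards [eventually_ge_atTop (-N)] with n hn
  have := hN (-(n + 1)) (by omega)
  rwa [show -(n + 1) + 1 = -n by ring] at this

theorem forall_of_iff_add_one {c : ℤ → Prop} (h : ∀ n, c n ↔ c (n + 1)) {k : ℤ} (hk : c k)
    (n : ℤ) : c n := by
  induction n using Int.inductionOn' (b := k) with
  | zero => exact hk
  | succ n _ ih => exact (h n).1 ih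
  | pred n _ ih => exact (h (n - 1)).2 (by simpa using ih)

end Sequences

section
variable {H : Type u} [NormedAddCommGroup H] [InnerProductSpace ℂ H]

/-- The closed linear span of a family of vectors. -/
def closedSpan {ι : Type*} (v : ι → H) : Submodule ℂ H :=
  (Submodule.span ℂ (Set.range v)).topologicalClosure

theorem isClosed_closedSpan {ι : Type*} (v : ι → H) : IsClosed (closedSpan v : Set H) :=
  Submodule.isClosed_topologicalClosure _

instance [CompleteSpace H] {ι : Type*} (v : ι → H) : CompleteSpace (closedSpan v) :=
  (isClosed_closedSpan v).completeSpace_coe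

theorem mem_closedSpan {ι : Type*} (v : ι → H) (i : ι) : v i ∈ closedSpan v :=
  Submodule.le_topologicalClosure _ (Submodule.subset_span ⟨i, rfl⟩)

theorem closedSpan_le {ι : Type*} {v : ι → H} {M : Submodule ℂ H} (hM : IsClosed (M : Set H))
    (h : ∀ i, v i ∈ M) : closedSpan v ≤ M :=
  Submodule.topologicalClosure_minimal _ (Submodule.span_le.2 (Set.range_subset_iff.2 h)) hM

theorem map_mem_of_mem_closedSpan {ι : Type*} {v : ι → H} {M : Submodule ℂ H}
    (hM : IsClosed (M : Set H)) (B : H →L[ℂ] H) (h : ∀ i, B (v i) ∈ M) {x : H}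
    (hx : x ∈ closedSpan v) : B x ∈ M :=
  closedSpan_le (M := M.comap (B : H →ₗ[ℂ] H)) (hM.preimage B.continuous) h hx

theorem mem_orthogonal_closedSpan {ι : Type*} {v : ι → H} {x : H} :
    x ∈ (closedSpan v)ᗮ ↔ ∀ i, inner ℂ (v i) x = 0 := by
  refine ⟨fun hx i => hx _ (mem_closedSpan v i), fun h => ?_⟩
  have : closedSpan v ≤ (ℂ ∙ x)ᗮ := closedSpan_le (Submodule.isClosed_orthogonal _) fun i => by
    rw [Submodule.mem_orthogonal_singleton_iff_inner_left]; exact h i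
  intro y hy
  exact Submodule.mem_orthogonal_singleton_iff_inner_left.1 (this hy)

theorem inner_eq_zero_of_mem_closedSpan {ι κ : Type*} {v : ι → H} {v' : κ → H} {x y : H}
    (hx : x ∈ closedSpan v) (hy : y ∈ closedSpan v') (h : ∀ i j, inner ℂ (v i) (v' j) = 0) :
    inner ℂ x y = 0 := by
  have h1 : ∀ j, v' j ∈ (closedSpan v)ᗮ := fun j => mem_orthogonal_closedSpan.2 fun i => h i j
  exact closedSpan_le (Submodule.isClosed_orthogonal _) h1 hy x hx

/-- Bessel's inequality for mutually orthogonal subspaces, in its qualitative form. -/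
theorem tendsto_norm_starProjection {ι : Type*} (K : ι → Submodule ℂ H)
    [∀ i, (K i).HasOrthogonalProjection] (hK : ∀ i j, i ≠ j → K i ⟂ K j) (x : H) :
    Tendsto (fun i => ‖(K i).starProjection x‖) cofinite (𝓝 0) := by
  have hin : ∀ i, inner ℂ ((K i).starProjection x) x =
      ((‖(K i).starProjection x‖ ^ 2 : ℝ) : ℂ) := by
    intro i
    have h : inner ℂ ((K i).starProjection x) (x - (K i).starProjection x) = 0 :=
      (K i).sub_starProjection_mem_orthogonal x _ ((K i).starProjection_apply_mem x)
    rw [inner_sub_right, sub_eq_zero] at h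
    rw [h, inner_self_eq_norm_sq_to_K]
    push_cast
    rfl
  have hij : ∀ i j, i ≠ j → inner ℂ ((K i).starProjection x) ((K j).starProjection x) = 0 :=
    fun i j h => (hK i j h).inner_eq ((K i).starProjection_apply_mem x)
      ((K j).starProjection_apply_mem x)
  have hsum : Summable fun i => ‖(K i).starProjection x‖ ^ 2 := by
    refine summable_of_sum_le (c := ‖x‖ ^ 2) (fun i => by positivity) fun F => ?_
    set s := ∑ i ∈ F, ‖(K i).starProjection x‖ ^ 2 with hs
    set z := ∑ i ∈ F, (K i).starProjection x with hz
    have h1 : inner ℂ z x = (s : ℂ) := by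
      rw [hz, sum_inner, hs]
      push_cast
      exact Finset.sum_congr rfl fun i _ => by rw [hin]; push_cast; rfl
    have h2 : inner ℂ z z = (s : ℂ) := by
      rw [hz, sum_inner, hs]
      push_cast
      refine Finset.sum_congr rfl fun i hi => ?_
      rw [inner_sum, Finset.sum_eq_single_of_mem i hi fun j _ hj => hij i j hj.symm,
        inner_self_eq_norm_sq_to_K]
      rfl
    have h3 : ‖z‖ ^ 2 = s := by
      have := inner_self_eq_norm_sq_to_K (𝕜 := ℂ) z
      rw [h2] at this
      exact (Complex.ofReal_injective (by rw [this]; push_cast; rfl)).symm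
    have h4 : s ≤ ‖z‖ * ‖x‖ := by
      have := norm_inner_le_norm (𝕜 := ℂ) z x
      rw [h1, Complex.norm_real, Real.norm_eq_abs] at this
      exact (le_abs_self s).trans this
    nlinarith [norm_nonneg z, norm_nonneg x, sq_nonneg (‖z‖ - ‖x‖)]
  have := (hsum.tendsto_cofinite_zero).sqrt
  simpa using this

variable [CompleteSpace H]

/-- The closed span of the vectors at position `n` in the side chains with home `m`. -/
noncomputable def chainSub {G : Type*} (T : HilbertBasis (ℤ × Option (ℤ × G)) ℂ H) (n m : ℤ) :
    Submodule ℂ H :=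
  closedSpan fun k : G => T (n, some (m, k))

instance {G : Type*} (T : HilbertBasis (ℤ × Option (ℤ × G)) ℂ H) (n m : ℤ) :
    CompleteSpace (chainSub T n m) :=
  inferInstanceAs (CompleteSpace (closedSpan _))

/-- Two orthonormal bases adapted to `A` and to the bilateral shift `U` with
`U (S (n, c)) = T (n + 1, c)`. The first index is the position `n : ℤ`, the second one names a
chain: `none` is the main chain and `some (m, k)` a side chain with home `m`, so that `U A` moves
position `n` to position `n + 1`. The two bases may differ along the main chain and on side chains
at their homes. -/
structure IsShiftModel {G : Type*} (A : H →L[ℂ] H) (w : ℤ → ℝ)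
    (T S : HilbertBasis (ℤ × Option (ℤ × G)) ℂ H) : Prop where
  /-- `A` respects the side chains with a given home. -/
  map_chain : ∀ n m k, A (S (n, some (m, k))) ∈ chainSub T n m
  /-- Away from their homes the side chains are the same in both bases. -/
  eq_of_ne : ∀ n m k, n ≠ m → S (n, some (m, k)) = T (n, some (m, k))
  /-- `U A` is a weighted shift on the main chain. -/
  map_main : ∀ n, A (T (n, none)) = (w n : ℂ) • S (n, none)
  weight_ne : ∀ n, w n ≠ 0
  /-- A side chain at its home can only interact with the main vector of the same position. -/
  main_orth : ∀ n m k, n ≠ m → inner ℂ (T (m, some (m, k))) (A (S (n, none))) = 0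
  /-- For each position, both bases span the same closed subspace. -/
  position : ∀ n m c c', n ≠ m → inner ℂ (T (m, c')) (S (n, c)) = 0

namespace IsShiftModel

variable {G : Type*} {A : H →L[ℂ] H} {w : ℤ → ℝ} {T S : HilbertBasis (ℤ × Option (ℤ × G)) ℂ H}
  {U : H ≃ₗᵢ[ℂ] H}

/-- A square-summable solution of the main chain recurrence is an eigenvector of `U A`. -/
theorem mem_pointSpectrum (hM : IsShiftModel A w T S) (hU : ∀ n c, U (S (n, c)) = T (n + 1, c))
    {z : ℂ} {c : ℤ → ℂ} (hc0 : c ≠ 0) (hc : Summable fun n => ‖c n‖ ^ 2)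
    (hrec : ∀ n, z * c (n + 1) = w n * c n) :
    z ∈ pointSpectrum ((U : H →L[ℂ] H) * A) := by
  have hu : Orthonormal ℂ fun n : ℤ => T (n, none) :=
    T.orthonormal.comp _ fun a b h => by simpa using h
  set f : lp (fun _ : ℤ => ℂ) 2 := ⟨c, memℓp_gen (by simpa using hc)⟩ with hf
  set x := hu.orthogonalFamily.linearIsometry f with hx
  have hsum : HasSum (fun n => c n • T (n, none)) x := by
    have := hu.orthogonalFamily.hasSum_linearIsometry f
    simpa using this
  have hx0 : x ≠ 0 := by
    intro h0
    have : f = 0 := by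
      rw [← norm_eq_zero, ← hu.orthogonalFamily.linearIsometry.norm_map, ← hx, h0, norm_zero]
    apply hc0
    have h2 : (f : ∀ _ : ℤ, ℂ) = 0 := by rw [this]; rfl
    exact h2
  have h1 : HasSum (fun n => (U : H →L[ℂ] H) (A (c n • T (n, none)))) (U (A x)) :=
    (hsum.mapL A).mapL (U : H →L[ℂ] H)
  have h2 : (fun n => (U : H →L[ℂ] H) (A (c n • T (n, none)))) =
      (fun n => z • c n • T (n, none)) ∘ (Equiv.addRight (1 : ℤ)) := by
    funext n
    have : (U : H →L[ℂ] H) (A (c n • T (n, none))) = (w n * c n) • U (S (n, none)) := by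
      simp [hM.map_main, ← smul_smul, smul_comm (c n)]
    rw [this, hU, ← hrec]
    simp [smul_smul]
  rw [h2, Equiv.hasSum_iff] at h1
  have h3 : U (A x) = z • x := h1.unique (hsum.const_smul z)
  exact Module.End.hasEigenvalue_of_hasEigenvector (x := x)
    ⟨Module.End.mem_eigenspace_iff.2 h3, hx0⟩

theorem starProjection_map (hU : ∀ n c, U (S (n, c)) = T (n + 1, c)) (n m : ℤ) (x : H) :
    (chainSub T (n + 1) m).starProjection (U x) = U ((chainSub S n m).starProjection x) := by
  refine Submodule.eq_starProjection_of_mem_orthogonal ?_ ?_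
  · refine map_mem_of_mem_closedSpan (isClosed_closedSpan _) (U : H →L[ℂ] H) (fun k => ?_)
      (Submodule.starProjection_apply_mem _ x)
    change U (S (n, some (m, k))) ∈ _
    rw [hU]
    exact mem_closedSpan (fun k : G => T (n + 1, some (m, k))) k
  · rw [← map_sub]
    refine mem_orthogonal_closedSpan.2 fun k => ?_
    rw [← hU, U.inner_map_map]
    exact mem_orthogonal_closedSpan.1
      ((chainSub S n m).sub_starProjection_mem_orthogonal x) k

/-- The component of `A x` in a block of side chains depends only on that of `x`. -/
theorem starProjection_map_starProjection (hM : IsShiftModel A w T S) (hA : IsSelfAdjoint A)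
    (n m : ℤ) (x : H) : (chainSub S n m).starProjection (A x) =
      (chainSub S n m).starProjection (A ((chainSub T n m).starProjection x)) := by
  rw [← sub_eq_zero, ← map_sub, ← map_sub, Submodule.starProjection_apply_eq_zero_iff]
  refine mem_orthogonal_closedSpan.2 fun k => ?_
  have hs := (ContinuousLinearMap.isSelfAdjoint_iff_isSymmetric.1 hA) (S (n, some (m, k)))
    (x - (chainSub T n m).starProjection x)
  exact hs.symm.trans (Submodule.sub_starProjection_mem_orthogonal x _ (hM.map_chain n m k))

omit [CompleteSpace H] in
theorem map_mem_chainSub (hM : IsShiftModel A w T S) {n m : ℤ} (hnm : n ≠ m) {x : H}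
    (hx : x ∈ chainSub T n m) : A x ∈ chainSub T n m :=
  map_mem_of_mem_closedSpan (isClosed_closedSpan _) A (fun k => by
    have := hM.map_chain n m k
    rwa [hM.eq_of_ne n m k hnm] at this) hx

omit [CompleteSpace H] in
theorem chainSub_eq (hM : IsShiftModel A w T S) {n m : ℤ} (hnm : n ≠ m) :
    chainSub S n m = chainSub T n m := by
  simp only [chainSub, hM.eq_of_ne n m _ hnm]

/-- At the home of a side chain, the compression of `A` to the complement of the main vector is
injective: a vector in its kernel is mapped by `A` to a multiple of `A (T (m, none))`. -/
theorem eq_zero_of_starProjection_map (hM : IsShiftModel A w T S) (hA : IsSelfAdjoint A)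
    (hinj : Function.Injective A) {m : ℤ} {y : H} (hy : y ∈ chainSub T m m)
    (h : (chainSub S m m).starProjection (A y) = 0) : y = 0 := by
  have hs := fun a b => (ContinuousLinearMap.isSelfAdjoint_iff_isSymmetric.1 hA) a b
  rw [Submodule.starProjection_apply_eq_zero_iff] at h
  have horth : ∀ i, i ≠ (m, none) → inner ℂ (S i) (A y) = 0 := by
    rintro ⟨n, _ | ⟨m', k⟩⟩ hi
    · have hn : n ≠ m := fun h => hi (by rw [h])
      refine (hs (S (n, none)) y).symm.trans ?_
      rw [inner_eq_zero_symm]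
      exact closedSpan_le (M := (ℂ ∙ A (S (n, none)))ᗮ) (Submodule.isClosed_orthogonal _)
        (fun k => Submodule.mem_orthogonal_singleton_iff_inner_left.2 (hM.main_orth n m k hn)) hy
        |> Submodule.mem_orthogonal_singleton_iff_inner_left.1
    · by_cases hnm : n = m ∧ m' = m
      · obtain ⟨rfl, rfl⟩ := hnm
        exact mem_orthogonal_closedSpan.1 h k
      · refine (hs (S (n, some (m', k))) y).symm.trans ?_
        refine inner_eq_zero_of_mem_closedSpan (hM.map_chain n m' k) hy fun k k' => ?_
        exact T.orthonormal.2 fun h => hnm (by simp at h; exact ⟨h.1, h.2.1⟩)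
  have h1 : A y = inner ℂ (S (m, none)) (A y) • S (m, none) := by
    rw [← sub_eq_zero]
    refine S.eq_zero_of_inner fun i => ?_
    by_cases hi : i = (m, none)
    · subst hi
      rw [inner_sub_right, inner_smul_right, inner_self_eq_norm_sq_to_K, S.orthonormal.1]
      simp
    · rw [inner_sub_right, inner_smul_right, horth i hi, S.orthonormal.2 hi]
      simp
  have hw : (w m : ℂ) ≠ 0 := by exact_mod_cast hM.weight_ne m
  have h2 : y = (inner ℂ (S (m, none)) (A y) / w m) • T (m, none) := by
    apply hinj
    rw [map_smul, hM.map_main, smul_smul, div_mul_cancel₀ _ hw]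
    exact h1
  have h3 : inner ℂ y (T (m, none)) = 0 := by
    refine inner_eq_zero_of_mem_closedSpan hy (mem_closedSpan (fun _ : Unit => T (m, none)) ())
      fun k _ => T.orthonormal.2 (by simp)
  rw [← inner_self_eq_zero (𝕜 := ℂ)]
  nth_rw 2 [h2]
  rw [inner_smul_right, h3, mul_zero]

/-- Let `A` be close to `α` on the side chains at positions near `+∞`, and close to `β` near `-∞`.
The components `y n` of an eigenvector of `U A` in the side chains with home `m` satisfy
`‖z‖ * ‖y (n + 1)‖ = ‖A (y n)‖` for `n ≠ m`. If they do not vanish, they are all nonzero, and as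
they tend to `0` at both ends, `α ≤ ‖z‖ ≤ β`. An eigenvector without such components is
concentrated on the main chain and solves its recurrence. -/
theorem of_mem_pointSpectrum (hM : IsShiftModel A w T S) (hU : ∀ n c, U (S (n, c)) = T (n + 1, c))
    (hA : IsSelfAdjoint A) (hinj : Function.Injective A) {α β : ℝ} (hβ0 : 0 ≤ β)
    (hα : ∀ m, ∀ d > 0, ∀ᶠ n in atTop, ∀ x ∈ chainSub T n m, ‖A x - (α : ℂ) • x‖ ≤ d * ‖x‖)
    (hβ : ∀ m, ∀ d > 0, ∀ᶠ n in atBot, ∀ x ∈ chainSub T n m, ‖A x - (β : ℂ) • x‖ ≤ d * ‖x‖)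
    {z : ℂ} (hz : z ∈ pointSpectrum ((U : H →L[ℂ] H) * A)) :
    z ≠ 0 ∧ ((α ≤ ‖z‖ ∧ ‖z‖ ≤ β) ∨ ∃ c : ℤ → ℂ, c ≠ 0 ∧ Tendsto c cofinite (𝓝 0) ∧
      ∀ n, z * c (n + 1) = w n * c n) := by
  obtain ⟨x, hx, hx0⟩ := Module.End.HasEigenvalue.exists_hasEigenvector hz
  replace hx : U (A x) = z • x := Module.End.mem_eigenspace_iff.1 hx
  have hz0 : z ≠ 0 := by
    rintro rfl
    rw [zero_smul, map_eq_zero_iff U U.injective, map_eq_zero_iff A hinj] at hx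
    exact hx0 hx
  refine ⟨hz0, ?_⟩
  have hrec : ∀ n m, z • (chainSub T (n + 1) m).starProjection x =
      U ((chainSub S n m).starProjection (A ((chainSub T n m).starProjection x))) := fun n m => by
    rw [← hM.starProjection_map_starProjection hA, ← starProjection_map hU, hx, map_smul]
  have hrec' : ∀ n m, n ≠ m → z • (chainSub T (n + 1) m).starProjection x =
      U (A ((chainSub T n m).starProjection x)) := fun n m hnm => by
    have h1 := hM.map_mem_chainSub hnm ((chainSub T n m).starProjection_apply_mem x)
    have h2 := (hM.chainSub_eq hnm).ge h1
    rw [hrec, Submodule.starProjection_eq_self_iff.2 h2]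
  by_cases hy : ∃ n m, (chainSub T n m).starProjection x ≠ 0
  · left
    obtain ⟨k, m, hk⟩ := hy
    set y : ℤ → H := fun n => (chainSub T n m).starProjection x with hydef
    have hyne : ∀ n, y n ≠ 0 := by
      refine forall_of_iff_add_one (fun n => not_congr ?_) hk
      by_cases hnm : n = m
      · subst hnm
        constructor
        · intro h
          have := hrec n n
          rw [show (chainSub T n n).starProjection x = 0 from h] at this
          simpa [hz0] using this
        · intro h
          have := hrec n n
          rw [show (chainSub T (n + 1) n).starProjection x = 0 from h, smul_zero, eq_comm,
            map_eq_zero_iff U U.injective] at this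
          exact hM.eq_zero_of_starProjection_map hA hinj
            (Submodule.starProjection_apply_mem _ x) this
      · constructor
        · intro h
          have := hrec' n m hnm
          rw [show (chainSub T n m).starProjection x = 0 from h] at this
          simpa [hz0] using this
        · intro h
          have := hrec' n m hnm
          rw [show (chainSub T (n + 1) m).starProjection x = 0 from h, smul_zero, eq_comm,
            map_eq_zero_iff U U.injective, map_eq_zero_iff A hinj] at this
          exact this
    have hpos : ∀ n, 0 < ‖y n‖ := fun n => norm_pos_iff.2 (hyne n)
    have hlim : Tendsto (fun n => ‖y n‖) cofinite (𝓝 0) :=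
      tendsto_norm_starProjection (fun n => chainSub T n m) (fun i j hij => by
        rw [Submodule.isOrtho_iff_inner_eq]
        exact fun a ha b hb => inner_eq_zero_of_mem_closedSpan ha hb fun k k' =>
          T.orthonormal.2 fun h => hij (by simp at h; exact h.1)) x
    have hnorm : ∀ n, n ≠ m → ‖z‖ * ‖y (n + 1)‖ = ‖A (y n)‖ := fun n hnm => by
      rw [← norm_smul, hydef, hrec' n m hnm, U.norm_map]
    have hzpos : 0 < ‖z‖ := norm_pos_iff.2 hz0
    constructor
    · by_contra! hlt
      refine not_tendsto_zero_of_eventually_le_succ hpos hlim ?_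
      filter_upwards [hα m (α - ‖z‖) (by linarith), eventually_gt_atTop m] with n hn hnm
      have h1 := hn (y n) (Submodule.starProjection_apply_mem _ x)
      have h2 := norm_sub_norm_le ((α : ℂ) • y n) (A (y n))
      rw [norm_sub_rev, norm_smul, Complex.norm_real, Real.norm_eq_abs] at h2
      have h3 := mul_le_mul_of_nonneg_right (le_abs_self α) (hpos n).le
      have h4 := hnorm n hnm.ne'
      refine le_of_mul_le_mul_left ?_ hzpos
      linarith
    · by_contra! hlt
      refine not_tendsto_zero_of_eventually_succ_le hpos hlim ?_
      filter_upwards [hβ m (‖z‖ - β) (by linarith), eventually_lt_atBot m] with n hn hnm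
      have h1 := hn (y n) (Submodule.starProjection_apply_mem _ x)
      have h2 := norm_sub_norm_le (A (y n)) ((β : ℂ) • y n)
      rw [norm_smul, Complex.norm_real, Real.norm_eq_abs, abs_of_nonneg hβ0] at h2
      have h4 := hnorm n hnm.ne
      refine le_of_mul_le_mul_left ?_ hzpos
      linarith
  · right
    push Not at hy
    have hside : ∀ n p, inner ℂ (T (n, some p)) x = 0 := fun n ⟨m, k⟩ =>
      mem_orthogonal_closedSpan.1
        ((Submodule.starProjection_apply_eq_zero_iff (chainSub T n m)).1 (hy n m)) k
    refine ⟨fun n => inner ℂ (T (n, none)) x, fun h0 => hx0 (T.eq_zero_of_inner ?_), ?_,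
      fun n => ?_⟩
    · rintro ⟨n, _ | p⟩
      · exact congrFun h0 n
      · exact hside n p
    · have h1 := T.orthonormal.inner_products_summable x
      have h2 := (h1.tendsto_cofinite_zero).sqrt
      have h3 := h2.comp (f := fun n : ℤ => ((n, none) : ℤ × Option (ℤ × G)))
        (Function.Injective.tendsto_cofinite fun a b h => by simpa using h)
      rw [tendsto_zero_iff_norm_tendsto_zero]
      simpa [Function.comp_def] using h3
    · have h1 : z * inner ℂ (T (n + 1, none)) x = inner ℂ (S (n, none)) (A x) := by
        rw [← inner_smul_right, ← hx, ← hU, U.inner_map_map]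
      have h2 : HasSum (fun i => T.repr x i * inner ℂ (S (n, none)) (A (T i)))
          (inner ℂ (S (n, none)) (A x)) := by
        have := ((T.hasSum_repr x).mapL A).mapL (innerSL ℂ (S (n, none)))
        simpa using this
      rw [h1, h2.unique (hasSum_single (n, none) ?_)]
      · rw [hM.map_main, inner_smul_right, inner_self_eq_norm_sq_to_K, S.orthonormal.1,
          T.repr_apply_apply]
        simp [mul_comm]
      · rintro ⟨k, _ | p⟩ hi
        · rw [hM.map_main, inner_smul_right, S.orthonormal.2 hi.symm]
          simp
        · rw [T.repr_apply_apply, hside, zero_mul]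

end IsShiftModel
end

/-! ### Construction of shift models -/

section
variable {H : Type u} [NormedAddCommGroup H] [InnerProductSpace ℂ H]

theorem Orthonormal.countable_index [TopologicalSpace.SeparableSpace H] {ι : Type*} {v : ι → H}
    (hv : Orthonormal ℂ v) : Countable ι := by
  have hdist : ∀ i j, i ≠ j → 1 ≤ dist (v i) (v j) := fun i j hij => by
    have h := @norm_sub_sq ℂ H _ _ _ (v i) (v j)
    rw [hv.2 hij, hv.1, hv.1] at h
    rw [dist_eq_norm]
    simp at h
    nlinarith [norm_nonneg (v i - v j)]
  have hdisj : Pairwise (Function.onFun Disjoint fun i => Metric.ball (v i) (1 / 2)) :=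
    fun i j hij => Metric.ball_disjoint_ball (by linarith [hdist i j hij])
  have := Set.PairwiseDisjoint.countable_of_isOpen (s := fun i => Metric.ball (v i) (1 / 2))
    (a := Set.univ) (fun i _ j _ hij => hdisj hij) (fun i _ => Metric.isOpen_ball)
    (fun i _ => ⟨v i, Metric.mem_ball_self (by norm_num)⟩)
  exact Set.countable_univ_iff.1 this

theorem not_finite_inf_orthogonal_singleton {M : Submodule ℂ H} (hM : ¬ FiniteDimensional ℂ M)
    {u : H} (hu : u ∈ M) (hu1 : ‖u‖ = 1) : ¬ FiniteDimensional ℂ ↥(M ⊓ (ℂ ∙ u)ᗮ) := by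
  intro hfin
  refine hM (Submodule.finiteDimensional_of_le (S₂ := (M ⊓ (ℂ ∙ u)ᗮ) ⊔ (ℂ ∙ u)) fun x hx => ?_)
  rw [← sub_add_cancel x (inner ℂ u x • u)]
  refine Submodule.add_mem_sup ⟨sub_mem hx (Submodule.smul_mem _ _ hu), ?_⟩
    (Submodule.smul_mem _ _ (Submodule.mem_span_singleton_self u))
  rw [SetLike.mem_coe, Submodule.mem_orthogonal_singleton_iff_inner_right, inner_sub_right,
    inner_smul_right, inner_self_eq_norm_sq_to_K, hu1]
  simp

theorem not_finite_of_orthogonal_family {J : Type*} {Z : J → Submodule ℂ H} (hZ0 : ∀ i, Z i ≠ ⊥)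
    (hZ : ∀ i j, i ≠ j → Z i ⟂ Z j) {s : Set J} (hs : s.Infinite) {M : Submodule ℂ H}
    (hM : ∀ i ∈ s, Z i ≤ M) : ¬ FiniteDimensional ℂ M := by
  intro hfin
  choose z hz hz0 using fun i => (Z i).ne_bot_iff.1 (hZ0 i)
  have hli : LinearIndependent ℂ fun i : s => (⟨z i, hM i i.2 (hz i)⟩ : M) :=
    linearIndependent_of_ne_zero_of_inner_eq_zero (fun i h => hz0 i (congrArg Subtype.val h))
      fun i j hij => (hZ i j fun h => hij (Subtype.ext h)).inner_eq (hz i) (hz j)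
  have := hli.finite
  exact hs s.toFinite

variable [CompleteSpace H]

theorem exists_orthonormal_closedSpan_eq [TopologicalSpace.SeparableSpace H] {M : Submodule ℂ H}
    (hMc : IsClosed (M : Set H)) (hM : ¬ FiniteDimensional ℂ M) :
    ∃ b : ℕ → H, Orthonormal ℂ b ∧ closedSpan b = M := by
  have : CompleteSpace M := hMc.completeSpace_coe
  obtain ⟨w, b, -⟩ := exists_hilbertBasis ℂ M
  have := b.infinite_index hM
  have := b.orthonormal.countable_index
  obtain ⟨_⟩ := nonempty_denumerable w
  set f : ℕ ≃ w := (Denumerable.eqv w).symm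
  have ho : Orthonormal ℂ fun i => (b (f i) : H) :=
    (b.orthonormal.comp _ f.injective).comp_linearIsometry M.subtypeₗᵢ
  refine ⟨_, ho, le_antisymm (closedSpan_le hMc fun i => (b (f i)).2) fun x hx => ?_⟩
  have h0 : (⟨x, hx⟩ : M) - ⟨(closedSpan fun i => (b (f i) : H)).starProjection x,
      closedSpan_le hMc (fun i => (b (f i)).2) (Submodule.starProjection_apply_mem _ x)⟩ = 0 := by
    refine b.eq_zero_of_inner fun i => ?_
    have := mem_orthogonal_closedSpan.1
      ((closedSpan fun i => (b (f i) : H)).sub_starProjection_mem_orthogonal x) (f.symm i)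
    rw [f.apply_symm_apply] at this
    exact this
  rw [sub_eq_zero] at h0
  have h1 : x = (closedSpan fun i => (b (f i) : H)).starProjection x := congrArg Subtype.val h0
  rw [h1]
  exact Submodule.starProjection_apply_mem _ x

/-- The part of the block `K (n, m)` left to the side chains: all of it off the diagonal, the
orthogonal complement of the main vector `u n` on the diagonal. -/
noncomputable def sideSub (K : ℤ × ℤ → Submodule ℂ H) (u : ℤ → H) (n m : ℤ) : Submodule ℂ H :=
  if n = m then K (n, m) ⊓ (ℂ ∙ u n)ᗮ else K (n, m)

omit [CompleteSpace H] in
theorem sideSub_of_ne (K : ℤ × ℤ → Submodule ℂ H) (u : ℤ → H) {n m : ℤ} (h : n ≠ m) :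
    sideSub K u n m = K (n, m) := if_neg h

omit [CompleteSpace H] in
theorem sideSub_self (K : ℤ × ℤ → Submodule ℂ H) (u : ℤ → H) (n : ℤ) :
    sideSub K u n n = K (n, n) ⊓ (ℂ ∙ u n)ᗮ := if_pos rfl

omit [CompleteSpace H] in
theorem mem_sideSub_self {K : ℤ × ℤ → Submodule ℂ H} {u : ℤ → H} {n : ℤ} {x : H} :
    x ∈ sideSub K u n n ↔ x ∈ K (n, n) ∧ inner ℂ (u n) x = 0 := by
  rw [sideSub_self, Submodule.mem_inf, Submodule.mem_orthogonal_singleton_iff_inner_right]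

omit [CompleteSpace H] in
theorem sideSub_le (K : ℤ × ℤ → Submodule ℂ H) (u : ℤ → H) (n m : ℤ) :
    sideSub K u n m ≤ K (n, m) := by
  unfold sideSub
  split_ifs
  · exact inf_le_left
  · exact le_rfl

omit [CompleteSpace H] in
theorem isClosed_sideSub {K : ℤ × ℤ → Submodule ℂ H} (hKc : ∀ p, IsClosed (K p : Set H))
    (u : ℤ → H) (n m : ℤ) : IsClosed (sideSub K u n m : Set H) := by
  by_cases h : n = m
  · subst h
    rw [sideSub_self]
    exact (hKc _).inter (Submodule.isClosed_orthogonal _)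
  · rw [sideSub_of_ne K u h]
    exact hKc _

omit [CompleteSpace H] in
theorem not_finite_sideSub {K : ℤ × ℤ → Submodule ℂ H} (hKinf : ∀ p, ¬ FiniteDimensional ℂ (K p))
    {u : ℤ → H} (hu : ∀ n, u n ∈ K (n, n)) (hu1 : ∀ n, ‖u n‖ = 1) (n m : ℤ) :
    ¬ FiniteDimensional ℂ (sideSub K u n m) := by
  by_cases h : n = m
  · subst h
    rw [sideSub_self]
    exact not_finite_inf_orthogonal_singleton (hKinf _) (hu n) (hu1 n)
  · rw [sideSub_of_ne K u h]
    exact hKinf _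

/-- Given orthogonal blocks `K (n, m)` that fill the space and a unit vector `u n` in each diagonal
block, the main vectors `u n` and a choice of bases of the remaining parts form a Hilbert basis. The
choice `bas` depends on the subspace only; this makes the bases for two sequences of main vectors
agree off the diagonal. -/
theorem exists_adapted_basis {K : ℤ × ℤ → Submodule ℂ H} (hKc : ∀ p, IsClosed (K p : Set H))
    (hK : ∀ p q, p ≠ q → K p ⟂ K q) (hKt : ∀ x, (∀ p, ∀ y ∈ K p, inner ℂ y x = 0) → x = 0)
    (hKinf : ∀ p, ¬ FiniteDimensional ℂ (K p)) {bas : Submodule ℂ H → ℕ → H}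
    (hbas : ∀ M : Submodule ℂ H, IsClosed (M : Set H) → ¬ FiniteDimensional ℂ M →
      Orthonormal ℂ (bas M) ∧ closedSpan (bas M) = M)
    {u : ℤ → H} (hu : ∀ n, u n ∈ K (n, n)) (hu1 : ∀ n, ‖u n‖ = 1) :
    ∃ T : HilbertBasis (ℤ × Option (ℤ × ℕ)) ℂ H, (∀ n, T (n, none) = u n) ∧
      ∀ n m k, T (n, some (m, k)) = bas (sideSub K u n m) k := by
  have hb := fun n m => hbas _ (isClosed_sideSub hKc u n m) (not_finite_sideSub hKinf hu hu1 n m)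
  have hmem : ∀ n m k, bas (sideSub K u n m) k ∈ sideSub K u n m := fun n m k =>
    (hb n m).2.le (mem_closedSpan _ k)
  have hmix : ∀ n n' m k, inner ℂ (u n) (bas (sideSub K u n' m) k) = 0 := fun n n' m k => by
    by_cases h : (n, n) = (n', m)
    · obtain ⟨rfl, rfl⟩ := Prod.mk.inj h
      exact (mem_sideSub_self.1 (hmem n n k)).2
    · exact (hK _ _ h).inner_eq (hu n) (sideSub_le _ _ _ _ (hmem n' m k))
  set v : ℤ × Option (ℤ × ℕ) → H := fun i =>
    i.2.elim (u i.1) fun q => bas (sideSub K u i.1 q.1) q.2 with hv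
  have hvo : Orthonormal ℂ v := by
    constructor
    · rintro ⟨n, _ | ⟨m, k⟩⟩
      · exact hu1 n
      · exact (hb n m).1.1 k
    · rintro ⟨n, _ | ⟨m, k⟩⟩ ⟨n', _ | ⟨m', k'⟩⟩ hne
      · exact (hK _ _ fun h => hne (by simpa using h)).inner_eq (hu n) (hu n')
      · exact hmix n n' m' k'
      · exact inner_eq_zero_symm.1 (hmix n' n m k)
      · by_cases h : (n, m) = (n', m')
        · obtain ⟨rfl, rfl⟩ := Prod.mk.inj h
          exact (hb n m).1.2 fun h => hne (congrArg (fun k => (n, some (m, k))) h)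
        · exact (hK _ _ h).inner_eq (sideSub_le _ _ _ _ (hmem n m k))
            (sideSub_le _ _ _ _ (hmem n' m' k'))
  obtain ⟨T, hT⟩ := hvo.exists_hilbertBasis_of_total fun x hx => by
    have h1 : ∀ n m, ∀ y ∈ sideSub K u n m, inner ℂ y x = 0 := fun n m y hy => by
      rw [← (hb n m).2] at hy
      exact mem_orthogonal_closedSpan.2 (fun k => hx (n, some (m, k))) y hy
    refine hKt x fun ⟨n, m⟩ y hy => ?_
    by_cases h : n = m
    · subst h
      have h2 : y - inner ℂ (u n) y • u n ∈ sideSub K u n n := by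
        refine mem_sideSub_self.2 ⟨sub_mem hy (Submodule.smul_mem _ _ (hu n)), ?_⟩
        rw [inner_sub_right, inner_smul_right, inner_self_eq_norm_sq_to_K, hu1]
        simp
      have h3 := h1 n n _ h2
      have h4 : inner ℂ (u n) x = 0 := hx (n, none)
      rwa [inner_sub_left, inner_smul_left, h4, mul_zero, sub_zero] at h3
    · exact h1 n m y (by rwa [sideSub_of_ne K u h])
  exact ⟨T, fun n => congrFun hT _, fun n m k => congrFun hT _⟩

/-- Mutually orthogonal nonzero invariant subspaces `Z i`, distributed over blocks indexed by
`ℤ × ℤ` with infinitely many of them in each block, give a shift model: the side chains with home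
`m` run through the blocks `(n, m)`, the main chain runs through the diagonal blocks, and the
orthogonal complement of all `Z i` is added to the block `(0, 0)`. A block with `n ≠ m` is the
closure of the sum of its `Z i`, so a closed subspace containing these contains its side chains. -/
theorem exists_isShiftModel [TopologicalSpace.SeparableSpace H] {A : H →L[ℂ] H}
    (hA : IsSelfAdjoint A) {J : Type*} {Z : J → Submodule ℂ H} (hZ0 : ∀ i, Z i ≠ ⊥)
    (hZ : ∀ i j, i ≠ j → Z i ⟂ Z j) (hZinv : ∀ i, ∀ x ∈ Z i, A x ∈ Z i) {blk : J → ℤ × ℤ}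
    (hblk : ∀ p, {i | blk i = p}.Infinite) {u v : ℤ → H} {w : ℤ → ℝ} (hw : ∀ n, w n ≠ 0)
    (hu : ∀ n, u n ∈ ⨆ i ∈ {i | blk i = (n, n)}, Z i)
    (hu1 : ∀ n, ‖u n‖ = 1) (hv1 : ∀ n, ‖v n‖ = 1) (hAu : ∀ n, A (u n) = (w n : ℂ) • v n) :
    ∃ T S : HilbertBasis (ℤ × Option (ℤ × ℕ)) ℂ H, IsShiftModel A w T S ∧
      ∀ n m, n ≠ m → ∀ M : Submodule ℂ H, IsClosed (M : Set H) →
        (∀ i, blk i = (n, m) → Z i ≤ M) → chainSub T n m ≤ M := by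
  have hsym := fun a b => (ContinuousLinearMap.isSelfAdjoint_iff_isSymmetric.1 hA) a b
  set R : Set J → Submodule ℂ H := fun s => ⨆ i ∈ s, Z i with hR
  have hRle : ∀ {s : Set J} {i}, i ∈ s → Z i ≤ R s := fun {s i} hi => le_iSup₂_of_le i hi le_rfl
  have hRinv : ∀ s, ∀ x ∈ R s, A x ∈ R s := fun s =>
    show R s ≤ (R s).comap (A : H →ₗ[ℂ] H) from
      iSup₂_le fun i hi x hx => hRle hi (hZinv i x hx)
  have hRorth : ∀ {s t : Set J}, Disjoint s t → R s ⟂ R t := fun {s t} hst => by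
    simp only [hR, Submodule.isOrtho_iSup_left, Submodule.isOrtho_iSup_right]
    exact fun j hj i hi => hZ i j fun h => Set.disjoint_left.1 hst hi (h ▸ hj)
  set s0 : Set J := {i | blk i ≠ 0} with hs0
  set K : ℤ × ℤ → Submodule ℂ H := fun p =>
    if p = 0 then (R s0)ᗮ else (R {i | blk i = p}).topologicalClosure with hK
  have hK0 : K 0 = (R s0)ᗮ := if_pos rfl
  have hKp : ∀ {p}, p ≠ 0 → K p = (R {i | blk i = p}).topologicalClosure := fun h => if_neg h
  have hKc : ∀ p, IsClosed (K p : Set H) := fun p => by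
    by_cases hp : p = 0
    · rw [hp, hK0]; exact Submodule.isClosed_orthogonal _
    · rw [hKp hp]; exact Submodule.isClosed_topologicalClosure _
  have hRK : ∀ p, R {i | blk i = p} ≤ K p := fun p => by
    by_cases hp : p = 0
    · subst hp
      rw [hK0]
      refine hRorth (Set.disjoint_left.2 fun i hi hi' => hi' hi)
    · rw [hKp hp]; exact Submodule.le_topologicalClosure _
  have hK0orth : ∀ p, p ≠ 0 → K p ⟂ K 0 := fun p hp => by
    have h1 : R {i | blk i = p} ≤ R s0 :=
      iSup₂_le fun i hi => hRle (show blk i ≠ 0 from fun h => hp ((show blk i = p from hi) ▸ h))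
    rw [hKp hp, hK0]
    refine Submodule.topologicalClosure_minimal _ (h1.trans ?_) (Submodule.isClosed_orthogonal _)
    exact Submodule.le_orthogonal_orthogonal _
  have hKo : ∀ p q, p ≠ q → K p ⟂ K q := fun p q hpq => by
    by_cases hq : q = 0
    · subst hq; exact hK0orth p hpq
    by_cases hp : p = 0
    · subst hp; exact (hK0orth q hq).symm
    rw [hKp hp, hKp hq, Submodule.IsOrtho, Submodule.orthogonal_closure]
    refine Submodule.topologicalClosure_minimal _ ?_ (Submodule.isClosed_orthogonal _)
    exact hRorth (Set.disjoint_left.2 fun i hi hi' => hpq (hi.symm.trans hi'))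
  have hKinv : ∀ p, ∀ x ∈ K p, A x ∈ K p := fun p => by
    by_cases hp : p = 0
    · subst hp
      rw [hK0]
      intro x hx y hy
      rw [← show inner ℂ (A y) x = inner ℂ y (A x) from hsym y x]
      exact hx _ (hRinv _ y hy)
    · rw [hKp hp]
      intro x hx
      refine Submodule.topologicalClosure_minimal
        (t := (R {i | blk i = p}).topologicalClosure.comap (A : H →ₗ[ℂ] H)) _ ?_ ?_ hx
      · exact fun y hy => Submodule.le_topologicalClosure _ (hRinv _ y hy)
      · exact (Submodule.isClosed_topologicalClosure _).preimage A.continuous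
  have hKt : ∀ x, (∀ p, ∀ y ∈ K p, inner ℂ y x = 0) → x = 0 := fun x hx => by
    have h1 : R s0 ≤ (ℂ ∙ x)ᗮ := iSup₂_le fun i _ y hy =>
      Submodule.mem_orthogonal_singleton_iff_inner_left.2
        (hx (blk i) y (hRK _ (hRle (s := {j | blk j = blk i}) rfl hy)))
    have h2 : x ∈ K 0 := by
      rw [hK0]
      exact fun y hy => Submodule.mem_orthogonal_singleton_iff_inner_left.1 (h1 hy)
    exact inner_self_eq_zero.1 (hx 0 x h2)
  have hKinf : ∀ p, ¬ FiniteDimensional ℂ (K p) := fun p =>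
    not_finite_of_orthogonal_family hZ0 hZ (hblk p) fun i hi => (hRle hi).trans (hRK p)
  have huK : ∀ n, u n ∈ K (n, n) := fun n => hRK _ (hu n)
  have hvK : ∀ n, v n ∈ K (n, n) := fun n => by
    have h1 := hKinv _ _ (huK n)
    rw [hAu] at h1
    have hw' : (w n : ℂ) ≠ 0 := by exact_mod_cast hw n
    exact (Submodule.smul_mem_iff _ hw').1 h1
  have hex : ∀ M : Submodule ℂ H, ∃ b : ℕ → H, IsClosed (M : Set H) → ¬ FiniteDimensional ℂ M →
      Orthonormal ℂ b ∧ closedSpan b = M := fun M => by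
    by_cases h : IsClosed (M : Set H) ∧ ¬ FiniteDimensional ℂ M
    · obtain ⟨b, hb⟩ := exists_orthonormal_closedSpan_eq h.1 h.2
      exact ⟨b, fun _ _ => hb⟩
    · exact ⟨0, fun h1 h2 => absurd ⟨h1, h2⟩ h⟩
  choose bas hbas using hex
  obtain ⟨T, hTn, hTs⟩ := exists_adapted_basis hKc hKo hKt hKinf hbas huK hu1
  obtain ⟨S, hSn, hSs⟩ := exists_adapted_basis hKc hKo hKt hKinf hbas hvK hv1
  have hchT : ∀ n m, chainSub T n m = sideSub K u n m := fun n m => by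
    simp only [chainSub, hTs]
    exact (hbas _ (isClosed_sideSub hKc u n m) (not_finite_sideSub hKinf huK hu1 n m)).2
  have hchS : ∀ n m, chainSub S n m = sideSub K v n m := fun n m => by
    simp only [chainSub, hSs]
    exact (hbas _ (isClosed_sideSub hKc v n m) (not_finite_sideSub hKinf hvK hv1 n m)).2
  have hSmem : ∀ n m k, S (n, some (m, k)) ∈ sideSub K v n m := fun n m k =>
    (hchS n m).le (mem_closedSpan (fun k : ℕ => S (n, some (m, k))) k)
  have hTmem : ∀ n m k, T (n, some (m, k)) ∈ sideSub K u n m := fun n m k =>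
    (hchT n m).le (mem_closedSpan (fun k : ℕ => T (n, some (m, k))) k)
  have hTK : ∀ n c, ∃ m, T (n, c) ∈ K (n, m) := by
    rintro n (_ | ⟨m, k⟩)
    · exact ⟨n, by rw [hTn]; exact huK n⟩
    · exact ⟨m, sideSub_le _ _ _ _ (hTmem n m k)⟩
  have hSK : ∀ n c, ∃ m, S (n, c) ∈ K (n, m) := by
    rintro n (_ | ⟨m, k⟩)
    · exact ⟨n, by rw [hSn]; exact hvK n⟩
    · exact ⟨m, sideSub_le _ _ _ _ (hSmem n m k)⟩
  refine ⟨T, S, ⟨fun n m k => ?_, fun n m k hnm => ?_, fun n => by rw [hTn, hSn, hAu], hw,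
    fun n m k hnm => ?_, fun n m c c' hnm => ?_⟩, fun n m hnm M hM hZM => ?_⟩
  · rw [hchT]
    by_cases h : n = m
    · subst h
      obtain ⟨h1, h2⟩ := mem_sideSub_self.1 (hSmem n n k)
      -- `A` maps the complement of `v n` to that of `u n`, as `A (u n)` is a multiple of `v n`
      refine mem_sideSub_self.2 ⟨hKinv _ _ h1, ?_⟩
      rw [← show inner ℂ (A (u n)) (S (n, some (n, k))) =
        inner ℂ (u n) (A (S (n, some (n, k)))) from hsym _ _, hAu, inner_smul_left, h2, mul_zero]
    · rw [sideSub_of_ne K u h]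
      exact hKinv _ _ (sideSub_le _ _ _ _ (hSmem n m k))
  · rw [hTs, hSs]
    rw [sideSub_of_ne K u hnm, sideSub_of_ne K v hnm]
  · refine (hKo (m, m) (n, n) fun h => hnm (Prod.mk.inj h).1.symm).inner_eq
      (sideSub_le _ _ _ _ (hTmem m m k)) ?_
    rw [hSn]
    exact hKinv _ _ (hvK n)
  · obtain ⟨a, ha⟩ := hTK m c'
    obtain ⟨b, hb⟩ := hSK n c
    exact (hKo _ _ fun h => hnm (Prod.mk.inj h).1.symm).inner_eq ha hb
  · rw [hchT]
    refine (sideSub_le _ _ _ _).trans ?_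
    rw [hKp fun h => hnm (by
      have := Prod.mk.inj (h : (n, m) = ((0, 0) : ℤ × ℤ)); rw [this.1, this.2])]
    exact Submodule.topologicalClosure_minimal _ (iSup₂_le fun i hi => hZM i hi) hM
end

/-! ### Rings of eigenvalues -/

section Sequences

/-- The two summability conditions make the solution `c` of the main chain recurrence with `c 0 = 1`
square summable at `+∞` and at `-∞`. -/
theorem exists_solution {w : ℤ → ℝ} (hw : ∀ n, w n ≠ 0) {z : ℂ} (hz : z ≠ 0)
    (hp : Summable fun n : ℕ => ∏ k ∈ Finset.range (n + 1), (w k / ‖z‖) ^ 2)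
    (hm : Summable fun n : ℕ => ∏ k ∈ Finset.range (n + 1), (‖z‖ / w (-(k + 1))) ^ 2) :
    ∃ c : ℤ → ℂ, c ≠ 0 ∧ Summable (fun n => ‖c n‖ ^ 2) ∧ ∀ n, z * c (n + 1) = w n * c n := by
  have hwc : ∀ n, (w n : ℂ) ≠ 0 := fun n => by exact_mod_cast hw n
  set c : ℤ → ℂ := fun n => match n with
    | Int.ofNat n => ∏ k ∈ Finset.range n, ((w k : ℂ) / z)
    | Int.negSucc n => ∏ k ∈ Finset.range (n + 1), (z / (w (-(k + 1)) : ℂ)) with hc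
  have hcp : ∀ n : ℕ, c n = ∏ k ∈ Finset.range n, ((w k : ℂ) / z) := fun n => rfl
  have hcm : ∀ n : ℕ, c (-(n + 1)) = ∏ k ∈ Finset.range (n + 1), (z / (w (-(k + 1)) : ℂ)) :=
    fun n => by rw [← Int.negSucc_eq]
  refine ⟨c, fun h => ?_, Summable.of_nat_of_neg_add_one ?_ ?_, fun n => ?_⟩
  · have h1 : c ((0 : ℕ) : ℤ) = 0 := congrFun h 0
    rw [hcp] at h1
    simp at h1
  · rw [← summable_nat_add_iff 1]
    refine hp.congr fun n => ?_
    rw [hcp, norm_prod, ← Finset.prod_pow]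
    exact Finset.prod_congr rfl fun k _ => by
      rw [norm_div, Complex.norm_real, Real.norm_eq_abs, div_pow, div_pow, sq_abs]
  · refine hm.congr fun n => ?_
    rw [hcm, norm_prod, ← Finset.prod_pow]
    exact Finset.prod_congr rfl fun k _ => by
      rw [norm_div, Complex.norm_real, Real.norm_eq_abs, div_pow, div_pow, sq_abs]
  · rcases n with n | n
    · change z * c (n + 1 : ℕ) = w n * c n
      rw [hcp, hcp, Finset.prod_range_succ]
      field_simp
    · rw [Int.negSucc_eq, hcm]
      rcases n with _ | n
      · have h0 : c (-(((0 : ℕ) : ℤ) + 1) + 1) = 1 := by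
          rw [show -(((0 : ℕ) : ℤ) + 1) + 1 = ((0 : ℕ) : ℤ) by simp, hcp]; simp
        rw [h0]
        have := hwc (-(((0 : ℕ) : ℤ) + 1))
        simp only [zero_add, Finset.prod_range_one]
        simp only [CharP.cast_eq_zero, zero_add] at this ⊢
        field_simp
      · rw [show -(((n + 1 : ℕ) : ℤ) + 1) + 1 = -((n : ℤ) + 1) by push_cast; ring, hcm,
          Finset.prod_range_succ _ (n + 1)]
        have := hwc (-(((n + 1 : ℕ) : ℤ) + 1))
        field_simp

theorem summable_prod_sq_of_tendsto {r : ℕ → ℝ} {ρ : ℝ} (hr0 : ∀ k, r k ≠ 0)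
    (hr : Tendsto r atTop (𝓝 ρ)) (hρ : |ρ| < 1) :
    Summable fun n : ℕ => ∏ k ∈ Finset.range (n + 1), r k ^ 2 := by
  have h0 : ∀ n, ∏ k ∈ Finset.range (n + 1), r k ^ 2 ≠ 0 := fun n =>
    Finset.prod_ne_zero_iff.2 fun k _ => pow_ne_zero 2 (hr0 k)
  refine summable_of_ratio_test_tendsto_lt_one (l := ρ ^ 2) ?_ (Eventually.of_forall h0) ?_
  · rwa [sq_lt_one_iff_abs_lt_one]
  · have h1 := ((hr.comp (tendsto_add_atTop_nat 1)).pow 2)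
    refine h1.congr fun n => ?_
    rw [Finset.prod_range_succ _ (n + 1), norm_mul, mul_div_assoc, mul_comm, div_mul_cancel₀ _ (by
      simpa using h0 n)]
    simp

/-- A nonzero solution `c` cannot tend to `0` at `+∞` if `‖z‖ ≤ |w n|` there, since then `‖c n‖`
is increasing, and it cannot tend to `0` at `-∞` if `|w n| ≤ ‖z‖` there, since then it is
decreasing. -/
theorem not_eventually_le_weight {w : ℤ → ℝ} (hw : ∀ n, w n ≠ 0) {z : ℂ} (hz : z ≠ 0) {c : ℤ → ℂ}
    (hc0 : c ≠ 0) (hc : Tendsto c cofinite (𝓝 0)) (hrec : ∀ n, z * c (n + 1) = w n * c n) :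
    ¬ (∀ᶠ n in atTop, ‖z‖ ≤ |w n|) ∧ ¬ (∀ᶠ n in atBot, |w n| ≤ ‖z‖) := by
  have hwc : ∀ n, (w n : ℂ) ≠ 0 := fun n => by exact_mod_cast hw n
  obtain ⟨k, hk⟩ := Function.ne_iff.1 hc0
  have hne : ∀ n, c n ≠ 0 := fun n => forall_of_iff_add_one (c := fun n => c n ≠ 0) (fun n => by
    constructor
    · intro h h'
      have := hrec n
      rw [h', mul_zero, eq_comm, mul_eq_zero] at this
      exact this.elim (hwc n) h
    · intro h h'
      have := hrec n
      rw [h', mul_zero, mul_eq_zero] at this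
      exact this.elim hz h) hk n
  have hpos : ∀ n, 0 < ‖c n‖ := fun n => norm_pos_iff.2 (hne n)
  have hnorm : ∀ n, ‖z‖ * ‖c (n + 1)‖ = |w n| * ‖c n‖ := fun n => by
    rw [← norm_mul, hrec, norm_mul, Complex.norm_real, Real.norm_eq_abs]
  have hzpos : 0 < ‖z‖ := norm_pos_iff.2 hz
  refine ⟨fun h => not_tendsto_zero_of_eventually_le_succ hpos (by simpa using hc.norm) ?_,
    fun h => not_tendsto_zero_of_eventually_succ_le hpos (by simpa using hc.norm) ?_⟩
  · filter_upwards [h] with n hn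
    refine le_of_mul_le_mul_left ?_ hzpos
    rw [hnorm]
    exact mul_le_mul_of_nonneg_right hn (hpos n).le
  · filter_upwards [h] with n hn
    refine le_of_mul_le_mul_left ?_ hzpos
    rw [hnorm]
    exact mul_le_mul_of_nonneg_right hn (hpos n).le

end Sequences

section
variable {H : Type u} [NormedAddCommGroup H] [InnerProductSpace ℂ H]

/-- Two unit vectors generating mutually orthogonal orbits are rotated into each other to get a
prescribed value of `‖A u‖`. -/
theorem exists_unit_norm_map_eq (A : H →L[ℂ] H) {p q : H} (hp : ‖p‖ = 1) (hq : ‖q‖ = 1)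
    (hpq : inner ℂ p q = 0) (hApq : inner ℂ (A p) (A q) = 0) {w : ℝ} (h1 : ‖A p‖ < w)
    (h2 : w < ‖A q‖) : ∃ s t : ℂ, ‖s • p + t • q‖ = 1 ∧ ‖A (s • p + t • q)‖ = w := by
  have hpyth : ∀ (s t : ℝ) (x y : H), inner ℂ x y = 0 →
      ‖(s : ℂ) • x + (t : ℂ) • y‖ ^ 2 = s ^ 2 * ‖x‖ ^ 2 + t ^ 2 * ‖y‖ ^ 2 := by
    intro s t x y hxy
    have := norm_add_sq_eq_norm_sq_add_norm_sq_of_inner_eq_zero ((s : ℂ) • x) ((t : ℂ) • y)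
      (by rw [inner_smul_left, inner_smul_right, hxy, mul_zero, mul_zero])
    rw [pow_two, this, norm_smul, norm_smul, Complex.norm_real, Complex.norm_real,
      Real.norm_eq_abs, Real.norm_eq_abs]
    rw [← sq_abs s, ← sq_abs t]
    ring
  have hA0 := norm_nonneg (A p)
  set D := ‖A q‖ ^ 2 - ‖A p‖ ^ 2 with hD
  have hDpos : 0 < D := by nlinarith
  set θ := (w ^ 2 - ‖A p‖ ^ 2) / D with hθ
  have hθ0 : 0 ≤ θ := div_nonneg (by nlinarith) hDpos.le
  have hθ1 : 0 ≤ 1 - θ := by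
    rw [sub_nonneg, hθ, div_le_one hDpos]
    nlinarith
  have hθD : θ * D = w ^ 2 - ‖A p‖ ^ 2 := div_mul_cancel₀ _ hDpos.ne'
  refine ⟨((√(1 - θ) : ℝ) : ℂ), ((√θ : ℝ) : ℂ), ?_, ?_⟩
  · rw [← sq_eq_sq₀ (norm_nonneg _) zero_le_one, hpyth _ _ _ _ hpq, hp, hq, Real.sq_sqrt hθ0,
      Real.sq_sqrt hθ1]
    ring
  · rw [← sq_eq_sq₀ (norm_nonneg _) (by linarith), map_add, map_smul, map_smul,
      hpyth _ _ _ _ hApq, Real.sq_sqrt hθ0, Real.sq_sqrt hθ1]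
    linarith

variable [CompleteSpace H]

theorem eventually_forall_of_cofinite {κ : Type*} {P : κ → Prop} (hP : ∀ᶠ j in cofinite, P j)
    (g : κ → ℤ) : ∀ᶠ n in cofinite, ∀ j, g j = n → P j := by
  have : (g '' {j | ¬ P j}).Finite := (eventually_cofinite.1 hP).image g
  filter_upwards [this.eventually_cofinite_notMem] with n hn j hj
  by_contra h
  exact hn ⟨j, h, hj⟩

theorem norm_map_sub_norm_le {A : H →L[ℂ] H} (hA : IsSelfAdjoint A) {s d : ℝ} (hs : 0 ≤ s)
    (hd : 0 < d) {x : H} (hx : x ∈ spectralSub A s d) (hx1 : ‖x‖ = 1) :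
    s - d ≤ ‖A x‖ ∧ ‖A x‖ ≤ s + d := by
  have h := norm_sub_le_of_mem_spectralSub hA hd hx
  have h1 := norm_sub_norm_le (A x) ((s : ℂ) • x)
  have h2 := norm_sub_norm_le ((s : ℂ) • x) (A x)
  rw [norm_sub_rev] at h2
  rw [norm_smul, Complex.norm_real, Real.norm_eq_abs, abs_of_nonneg hs] at h1 h2
  rw [hx1] at h h1 h2
  constructor <;> linarith

/-- For two points `0 < l₁ < l₂` of the essential spectrum there is, for every ring between them, a
unitary spread `U` such that `U A` has all points of the ring as eigenvalues, and no others if `A`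
is injective. -/
theorem exists_unitarySpread_ring [TopologicalSpace.SeparableSpace H] {A : H →L[ℂ] H}
    (hA : IsSelfAdjoint A) {l₁ l₂ : ℝ} (hl₁ : 0 < l₁) (h₁ : (l₁ : ℂ) ∈ essentialSpectrum A)
    (h₂ : (l₂ : ℂ) ∈ essentialSpectrum A) {a b : ℝ} (ha : l₁ ≤ a) (hab : a < b) (hb : b ≤ l₂) :
    ∃ U : H →L[ℂ] H, IsUnitarySpread U ∧ openRing a b ⊆ pointSpectrum (U * A) ∧
      (Function.Injective A → pointSpectrum (U * A) ⊆ openRing a b) := by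
  -- a radius that keeps the spectral subspaces at `l₁` and `l₂` orthogonal
  set δ := (l₂ - l₁) / 3 with hδ
  have hδ0 : 0 < δ := by rw [hδ]; linarith
  have hseq : ∀ l : ℝ, (l : ℂ) ∈ essentialSpectrum A → ∃ X : ℕ → Submodule ℂ H,
      (∀ i, X i ≠ ⊥) ∧ (∀ i j, i ≠ j → X i ⟂ X j) ∧ (∀ i, ∀ x ∈ X i, A x ∈ X i) ∧
      (∀ i, X i ≤ spectralSub A l δ) ∧ ∀ d > 0, ∀ᶠ i in cofinite, X i ≤ spectralSub A l d := by
    intro l hl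
    refine exists_orthogonal_seq_spectralSub hA (isClosed_spectralSub A l δ)
      (fun x hx => map_mem_spectralSub l δ (Commute.refl A) hx) fun d hd hfin => ?_
    refine not_finite_spectralSub_of_mem_essentialSpectrum hA hl (lt_min hd hδ0)
      (Submodule.finiteDimensional_of_le (S₂ := spectralSub A l d ⊓ spectralSub A l δ) ?_)
    exact le_inf (spectralSub_mono A l (min_le_left _ _)) (spectralSub_mono A l (min_le_right _ _))
  obtain ⟨X, hX0, hXo, hXi, hXδ, hX⟩ := hseq l₁ h₁
  obtain ⟨Y, hY0, hYo, hYi, hYδ, hY⟩ := hseq l₂ h₂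
  have hXY : ∀ i j, X i ⟂ Y j := fun i j => by
    rw [Submodule.isOrtho_iff_inner_eq]
    refine fun x hx y hy => inner_eq_zero_of_mem_spectralSub hA ?_ (hXδ i hx) (hYδ j hy)
    rw [abs_of_neg (by linarith)]
    linarith
  set f : ℤ × ℤ × ℕ ≃ ℕ := Denumerable.eqv _ with hf
  set Z : (ℤ × ℤ × ℕ) ⊕ (ℤ × ℤ × ℕ) → Submodule ℂ H :=
    Sum.elim (fun j => X (f j)) (fun j => Y (f j)) with hZ
  -- `X` fills the blocks `(n, m)` with `n ≤ m` and `Y` those with `m ≤ n`: a side chain is near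
  -- `l₁` before its home and near `l₂` after it, and the home, where the main vectors are, has both
  set blk : (ℤ × ℤ × ℕ) ⊕ (ℤ × ℤ × ℕ) → ℤ × ℤ :=
    Sum.elim (fun j => (min j.1 j.2.1, max j.1 j.2.1)) (fun j => (max j.1 j.2.1, min j.1 j.2.1))
    with hblk
  have hfX : ∀ d > 0, ∀ᶠ j in cofinite, X (f j) ≤ spectralSub A l₁ d := fun d hd =>
    f.injective.tendsto_cofinite.eventually (hX d hd)
  have hfY : ∀ d > 0, ∀ᶠ j in cofinite, Y (f j) ≤ spectralSub A l₂ d := fun d hd =>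
    f.injective.tendsto_cofinite.eventually (hY d hd)
  -- weights strictly between `a` and `b` that tend to `a` at `+∞` and to `b` at `-∞`
  set w : ℤ → ℝ := fun n =>
    if 0 ≤ n then a + (b - a) / (n + 3) else b - (b - a) / (-n + 3) with hwdef
  have hwp : ∀ n : ℤ, 0 ≤ n → w n = a + (b - a) / (n + 3) := fun n hn => if_pos hn
  have hwm : ∀ n : ℤ, n < 0 → w n = b - (b - a) / (-n + 3) := fun n hn => if_neg (not_le.2 hn)
  have hba : 0 < b - a := by linarith
  have hq : ∀ x : ℝ, 0 ≤ x → 0 < (b - a) / (x + 3) ∧ (b - a) / (x + 3) < b - a := fun x hx =>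
    ⟨by positivity, div_lt_self hba (by linarith)⟩
  have hwab : ∀ n, a < w n ∧ w n < b := fun n => by
    rcases le_or_gt 0 n with hn | hn
    · have := hq n (by exact_mod_cast hn)
      rw [hwp n hn]
      constructor <;> linarith
    · have := hq (-n) (by have : (n : ℝ) < 0 := by exact_mod_cast hn
                          linarith)
      rw [hwm n hn]
      constructor <;> linarith
  have hwpos : ∀ n, 0 < w n := fun n => by linarith [(hwab n).1]
  have hwne : ∀ n, w n ≠ 0 := fun n => (hwpos n).ne'
  have hu : ∀ n, ∃ u, u ∈ ⨆ i ∈ {i | blk i = (n, n)}, Z i ∧ ‖u‖ = 1 ∧ ‖A u‖ = w n := by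
    intro n
    have hinj : Function.Injective fun k : ℕ => ((n, n, k) : ℤ × ℤ × ℕ) := fun k l h => by
      simpa using h
    have hd1 : 0 < (w n - l₁) / 2 := by linarith [(hwab n).1]
    have hd2 : 0 < (l₂ - w n) / 2 := by linarith [(hwab n).2]
    obtain ⟨k, hk⟩ := (hinj.tendsto_cofinite.eventually (hfX _ hd1)).exists
    obtain ⟨k', hk'⟩ := (hinj.tendsto_cofinite.eventually (hfY _ hd2)).exists
    obtain ⟨p, hp, hp0⟩ := (Submodule.ne_bot_iff _).1 (hX0 (f (n, n, k)))
    obtain ⟨q, hq, hq0⟩ := (Submodule.ne_bot_iff _).1 (hY0 (f (n, n, k')))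
    have hunit : ∀ x : H, x ≠ 0 → ‖((‖x‖ : ℂ))⁻¹ • x‖ = 1 := fun x hx => by
      exact_mod_cast norm_smul_inv_norm (𝕜 := ℂ) hx
    set p' := ((‖p‖ : ℂ))⁻¹ • p with hp'
    set q' := ((‖q‖ : ℂ))⁻¹ • q with hq'
    have hpm : p' ∈ X (f (n, n, k)) := Submodule.smul_mem _ _ hp
    have hqm : q' ∈ Y (f (n, n, k')) := Submodule.smul_mem _ _ hq
    have hn1 := norm_map_sub_norm_le hA hl₁.le hd1 (hk hpm) (hunit p hp0)
    have hn2 := norm_map_sub_norm_le hA (by linarith) hd2 (hk' hqm) (hunit q hq0)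
    obtain ⟨s, t, hst, hAst⟩ := exists_unit_norm_map_eq A (hunit p hp0) (hunit q hq0)
      ((hXY _ _).inner_eq hpm hqm) ((hXY _ _).inner_eq (hXi _ _ hpm) (hYi _ _ hqm)) (w := w n)
      (by linarith [(hwab n).1]) (by linarith [(hwab n).2])
    refine ⟨_, add_mem ?_ ?_, hst, hAst⟩
    · exact Submodule.mem_iSup_of_mem (Sum.inl (n, n, k))
        (Submodule.mem_iSup_of_mem (by simp [hblk]) (Submodule.smul_mem _ _ hpm))
    · exact Submodule.mem_iSup_of_mem (Sum.inr (n, n, k'))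
        (Submodule.mem_iSup_of_mem (by simp [hblk]) (Submodule.smul_mem _ _ hqm))
  choose u hu hu1 hAu using hu
  obtain ⟨T, S, hM, hch⟩ := exists_isShiftModel hA (Z := Z) (blk := blk) (u := u)
    (v := fun n => ((w n : ℂ))⁻¹ • A (u n)) (w := w)
    (by rintro (j | j); exacts [hX0 _, hY0 _])
    (by
      rintro (i | i) (j | j) hij
      · exact hXo _ _ fun h => hij (by rw [f.injective h])
      · exact hXY _ _
      · exact (hXY _ _).symm
      · exact hYo _ _ fun h => hij (by rw [f.injective h]))
    (by rintro (j | j); exacts [hXi _, hYi _])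
    (fun ⟨n, m⟩ => by
      rcases le_total n m with h | h
      · exact Set.infinite_of_injective_forall_mem (f := fun k : ℕ => Sum.inl (n, m, k))
          (fun k l h => by simpa using h) fun k => by simp [hblk, h]
      · exact Set.infinite_of_injective_forall_mem (f := fun k : ℕ => Sum.inr (n, m, k))
          (fun k l h => by simpa using h) fun k => by simp [hblk, h])
    hwne hu hu1
    (fun n => by
      rw [norm_smul, norm_inv, Complex.norm_real, Real.norm_eq_abs, abs_of_pos (hwpos n), hAu,
        inv_mul_cancel₀ (hwne n)])
    (fun n => by
      rw [smul_smul, mul_inv_cancel₀ (by exact_mod_cast hwne n), one_smul])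
  obtain ⟨U, hUs, hU⟩ := exists_unitarySpread_of_shift T S hM.position
  have hlimp : Tendsto (fun n : ℕ => w n) atTop (𝓝 a) := by
    have h1 : Tendsto (fun n : ℕ => a + (b - a) / ((n : ℝ) + 3)) atTop (𝓝 (a + 0)) :=
      tendsto_const_nhds.add (tendsto_const_nhds.div_atTop
        (tendsto_atTop_add_const_right _ _ tendsto_natCast_atTop_atTop))
    rw [add_zero] at h1
    refine h1.congr fun n => ?_
    rw [hwp n (by positivity)]
    simp
  have hlimm : Tendsto (fun n : ℕ => w (-(n + 1))) atTop (𝓝 b) := by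
    have h1 : Tendsto (fun n : ℕ => b - (b - a) / ((n : ℝ) + 4)) atTop (𝓝 (b - 0)) :=
      tendsto_const_nhds.sub (tendsto_const_nhds.div_atTop
        (tendsto_atTop_add_const_right _ _ tendsto_natCast_atTop_atTop))
    rw [sub_zero] at h1
    refine h1.congr fun n => ?_
    rw [hwm _ (by linarith [Int.natCast_nonneg n])]
    push_cast
    ring_nf
  refine ⟨U, hUs, fun z hz => ?_, fun hinj z hz => ?_⟩
  · have hzpos : 0 < ‖z‖ := by linarith [hz.1]
    have hz0 : z ≠ 0 := norm_pos_iff.1 hzpos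
    obtain ⟨c, hc0, hc, hrec⟩ := exists_solution hwne hz0
      (summable_prod_sq_of_tendsto (fun k => div_ne_zero (hwne _) hzpos.ne')
        (hlimp.div_const ‖z‖) (by
          rw [abs_of_nonneg (by have := hl₁.trans_le ha; positivity), div_lt_one hzpos]
          exact hz.1))
      (summable_prod_sq_of_tendsto (fun k => div_ne_zero hzpos.ne' (hwne _))
        (tendsto_const_nhds.div hlimm (by linarith)) (by
          have hb0 : 0 < b := by linarith
          rw [abs_of_nonneg (by positivity), div_lt_one hb0]; exact hz.2))
    exact hM.mem_pointSpectrum hU hc0 hc hrec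
  · have hout := hM.of_mem_pointSpectrum hU hA hinj (α := l₂) (β := l₁) hl₁.le
      (fun m d hd => by
        have h1 := (eventually_forall_of_cofinite (hfY d hd) fun j => max j.1 j.2.1).filter_mono
          (show (atTop : Filter ℤ) ≤ cofinite by rw [Int.cofinite_eq]; exact le_sup_right)
        filter_upwards [h1, eventually_gt_atTop m] with n hn hnm x hx
        refine norm_sub_le_of_mem_spectralSub hA hd (hch n m hnm.ne' _ (isClosed_spectralSub _ _ _)
          ?_ hx)
        rintro (j | j) hj
        · have := Prod.mk.inj (show (min j.1 j.2.1, max j.1 j.2.1) = (n, m) from hj)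
          have := min_le_max (a := j.1) (b := j.2.1)
          omega
        · exact hn j (Prod.mk.inj (show (max j.1 j.2.1, min j.1 j.2.1) = (n, m) from hj)).1)
      (fun m d hd => by
        have h1 := (eventually_forall_of_cofinite (hfX d hd) fun j => min j.1 j.2.1).filter_mono
          (show (atBot : Filter ℤ) ≤ cofinite by rw [Int.cofinite_eq]; exact le_sup_left)
        filter_upwards [h1, eventually_lt_atBot m] with n hn hnm x hx
        refine norm_sub_le_of_mem_spectralSub hA hd (hch n m hnm.ne _ (isClosed_spectralSub _ _ _)
          ?_ hx)
        rintro (j | j) hj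
        · exact hn j (Prod.mk.inj (show (min j.1 j.2.1, max j.1 j.2.1) = (n, m) from hj)).1
        · have := Prod.mk.inj (show (max j.1 j.2.1, min j.1 j.2.1) = (n, m) from hj)
          have := min_le_max (a := j.1) (b := j.2.1)
          omega)
      hz
    obtain ⟨hz0, ⟨h3, h4⟩ | ⟨c, hc0, hc, hrec⟩⟩ := hout
    · -- the side chains would force `l₂ ≤ ‖z‖ ≤ l₁`
      linarith
    · obtain ⟨h3, h4⟩ := not_eventually_le_weight hwne hz0 hc0 hc hrec
      constructor
      · by_contra! hle
        exact h3 (Eventually.of_forall fun n => by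
          rw [abs_of_pos (hwpos n)]; linarith [(hwab n).1])
      · by_contra! hle
        exact h4 (Eventually.of_forall fun n => by
          rw [abs_of_pos (hwpos n)]; linarith [(hwab n).2])
end

/-! ### A circle of eigenvalues -/

section
variable {H : Type u} [NormedAddCommGroup H] [InnerProductSpace ℂ H] [CompleteSpace H]

/-- For a self-adjoint operator, the points of the spectrum off the essential spectrum are
eigenvalues: an injective self-adjoint Fredholm operator has closed dense range. -/
theorem exists_eigenvector_of_notMem_essentialSpectrum {A : H →L[ℂ] H} (hA : IsSelfAdjoint A)
    {t : ℝ} (ht : (t : ℂ) ∈ spectrum ℂ A) (hte : (t : ℂ) ∉ essentialSpectrum A) :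
    ∃ x : H, ‖x‖ = 1 ∧ A x = (t : ℂ) • x := by
  have hF : ((t : ℂ) • ContinuousLinearMap.id ℂ H - A).IsFredholm := not_not.1 hte
  set B := (t : ℂ) • ContinuousLinearMap.id ℂ H - A with hB
  have hBsa : IsSelfAdjoint B := by
    refine IsSelfAdjoint.sub ?_ hA
    have h1 : IsSelfAdjoint (t : ℂ) := Complex.conj_ofReal t
    exact h1.smul (IsSelfAdjoint.one (R := H →L[ℂ] H))
  by_cases hker : ∃ x, x ≠ 0 ∧ B x = 0
  · obtain ⟨x, hx0, hx⟩ := hker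
    refine ⟨((‖x‖ : ℂ))⁻¹ • x, by exact_mod_cast norm_smul_inv_norm (𝕜 := ℂ) hx0, ?_⟩
    have : A x = (t : ℂ) • x := by
      simp only [hB, sub_apply, smul_apply, ContinuousLinearMap.id_apply,
        sub_eq_zero] at hx
      exact hx.symm
    rw [map_smul, this, smul_comm]
  · push Not at hker
    exfalso
    have hinj : Function.Injective B := (injective_iff_map_eq_zero B).2 fun x hx => by
      by_contra h
      exact hker x h hx
    have : CompleteSpace B.range := hF.isClosed_range.completeSpace_coe
    have hsurj : B.range = ⊤ := by
      rw [← Submodule.orthogonal_eq_bot_iff, Submodule.eq_bot_iff]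
      intro y hy
      refine hinj ?_
      rw [map_zero, ← inner_self_eq_zero (𝕜 := ℂ)]
      have h1 : inner ℂ (B (B y)) y = inner ℂ (B y) (B y) :=
        (ContinuousLinearMap.isSelfAdjoint_iff_isSymmetric.1 hBsa) (B y) y
      rw [← h1]
      exact hy _ ⟨B y, rfl⟩
    refine (spectrum.mem_iff.1 ht) ?_
    rw [Algebra.algebraMap_eq_smul_one]
    exact ContinuousLinearMap.isUnit_iff_bijective.2 ⟨hinj, LinearMap.range_eq_top.1 hsurj⟩

theorem inner_eq_zero_of_eigenvectors {A : H →L[ℂ] H} (hA : IsSelfAdjoint A) {s t : ℝ}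
    (hst : s ≠ t) {x y : H} (hx : A x = (s : ℂ) • x) (hy : A y = (t : ℂ) • y) :
    inner ℂ x y = 0 := by
  have h1 : inner ℂ (A x) y = inner ℂ x (A y) :=
    (ContinuousLinearMap.isSelfAdjoint_iff_isSymmetric.1 hA) x y
  rw [hx, hy, inner_smul_left, inner_smul_right, Complex.conj_ofReal, ← sub_eq_zero, ← sub_mul,
    mul_eq_zero, sub_eq_zero] at h1
  exact h1.resolve_left fun h => hst (by exact_mod_cast h)

theorem invariant_orthogonal {A : H →L[ℂ] H} (hA : IsSelfAdjoint A) {D : Submodule ℂ H}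
    (hD : ∀ x ∈ D, A x ∈ D) {x : H} (hx : x ∈ Dᗮ) : A x ∈ Dᗮ := by
  intro y hy
  have h1 : inner ℂ (A y) x = inner ℂ y (A x) :=
    (ContinuousLinearMap.isSelfAdjoint_iff_isSymmetric.1 hA) y x
  rw [← h1]
  exact hx _ (hD y hy)

/-- If all weights, on the main chain as well as on side chains, tend to `l` at both ends, then only
the circle of radius `l` can contain eigenvalues, and it consists of eigenvalues if the main chain
recurrence has square-summable solutions there. -/
theorem IsShiftModel.pointSpectrum_eq_circle {G : Type*} {A : H →L[ℂ] H} {w : ℤ → ℝ}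
    {T S : HilbertBasis (ℤ × Option (ℤ × G)) ℂ H} {U : H ≃ₗᵢ[ℂ] H} (hM : IsShiftModel A w T S)
    (hU : ∀ n c, U (S (n, c)) = T (n + 1, c)) (hA : IsSelfAdjoint A) (hinj : Function.Injective A)
    {l : ℝ} (hl : 0 < l)
    (hch : ∀ m, ∀ d > 0, ∀ᶠ n in cofinite, ∀ x ∈ chainSub T n m, ‖A x - (l : ℂ) • x‖ ≤ d * ‖x‖)
    (hwp : Tendsto (fun n : ℕ => w n) atTop (𝓝 l))
    (hwm : Tendsto (fun n : ℕ => w (-(n + 1))) atTop (𝓝 l))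
    (hp : Summable fun n : ℕ => ∏ k ∈ Finset.range (n + 1), (w k / l) ^ 2)
    (hm : Summable fun n : ℕ => ∏ k ∈ Finset.range (n + 1), (l / w (-(k + 1))) ^ 2) :
    pointSpectrum ((U : H →L[ℂ] H) * A) = circleOfRadius l := by
  ext z
  constructor
  · intro hz
    rw [Int.cofinite_eq] at hch
    obtain ⟨hz0, ⟨h3, h4⟩ | ⟨c, hc0, hc, hrec⟩⟩ := hM.of_mem_pointSpectrum hU hA hinj hl.le
      (fun m d hd => (hch m d hd).filter_mono le_sup_right)
      (fun m d hd => (hch m d hd).filter_mono le_sup_left) hz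
    · exact le_antisymm h4 h3
    · obtain ⟨h3, h4⟩ := not_eventually_le_weight hM.weight_ne hz0 hc0 hc hrec
      refine le_antisymm (not_lt.1 fun hlt => h4 ?_) (not_lt.1 fun hlt => h3 ?_)
      · obtain ⟨N, hN⟩ := eventually_atTop.1 (hwm.abs.eventually (gt_mem_nhds (by
          rwa [abs_of_pos hl])))
        filter_upwards [eventually_le_atBot (-(N : ℤ) - 1)] with n hn
        have := hN (-n - 1).toNat (by omega)
        rw [show -((((-n - 1).toNat : ℕ) : ℤ) + 1) = n by omega] at this
        exact this.le
      · obtain ⟨N, hN⟩ := eventually_atTop.1 (hwp.abs.eventually (lt_mem_nhds (by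
          rwa [abs_of_pos hl])))
        filter_upwards [eventually_ge_atTop (N : ℤ)] with n hn
        have := hN n.toNat (by omega)
        rw [show ((n.toNat : ℕ) : ℤ) = n by omega] at this
        exact this.le
  · intro hz
    replace hz : ‖z‖ = l := hz
    obtain ⟨c, hc0, hc, hrec⟩ := exists_solution hM.weight_ne (norm_pos_iff.1 (hz ▸ hl))
      (by rwa [hz]) (by rwa [hz])
    exact hM.mem_pointSpectrum hU hc0 hc hrec

/-- The circle case for a bilateral sequence of eigenvectors whose orthogonal complement is either
infinite dimensional, and then carries the side chains, or trivial. -/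
theorem exists_unitarySpread_circle [TopologicalSpace.SeparableSpace H] {A : H →L[ℂ] H}
    (hA : IsSelfAdjoint A) (hinj : Function.Injective A) {l : ℝ} (hl : 0 < l)
    (hess : essentialSpectrum A = {(l : ℂ)}) {u : ℤ → H} (hu : Orthonormal ℂ u) {w : ℤ → ℝ}
    (hAu : ∀ n, A (u n) = (w n : ℂ) • u n)
    (hD : (closedSpan u)ᗮ = ⊥ ∨ ¬ FiniteDimensional ℂ ↥((closedSpan u)ᗮ))
    (hwp : Tendsto (fun n : ℕ => w n) atTop (𝓝 l))
    (hwm : Tendsto (fun n : ℕ => w (-(n + 1))) atTop (𝓝 l))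
    (hp : Summable fun n : ℕ => ∏ k ∈ Finset.range (n + 1), (w k / l) ^ 2)
    (hm : Summable fun n : ℕ => ∏ k ∈ Finset.range (n + 1), (l / w (-(k + 1))) ^ 2) :
    ∃ U : H →L[ℂ] H, IsUnitarySpread U ∧ pointSpectrum (U * A) = circleOfRadius l := by
  have hwne : ∀ n, w n ≠ 0 := fun n h => hu.ne_zero n (hinj (by rw [hAu, h]; simp))
  rcases hD with hD | hD
  · -- no side chains: the index type of the side chains of a home is `Empty`
    set v : ℤ × Option (ℤ × Empty) → H := fun i => u i.1 with hv
    have hnone : ∀ c : Option (ℤ × Empty), c = none := by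
      rintro (_ | ⟨-, ⟨⟩⟩); rfl
    have hvo : Orthonormal ℂ v := hu.comp _ fun i j h =>
      Prod.ext h ((hnone i.2).trans (hnone j.2).symm)
    obtain ⟨T, hT⟩ := hvo.exists_hilbertBasis_of_total fun x hx => by
      have : x ∈ (closedSpan u)ᗮ := mem_orthogonal_closedSpan.2 fun n => hx (n, none)
      rw [hD] at this
      exact this
    have hM : IsShiftModel A w T T :=
      ⟨fun _ _ k => k.elim, fun _ _ k => k.elim, fun n => by rw [hT]; exact hAu n, hwne,
        fun _ _ k => k.elim,
        fun n m c c' hnm => T.orthonormal.2 fun h => hnm (Prod.mk.inj h).1.symm⟩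
    obtain ⟨U, hUs, hU⟩ := exists_unitarySpread_of_shift T T hM.position
    refine ⟨U, hUs, hM.pointSpectrum_eq_circle hU hA hinj hl
      (fun m d hd => Eventually.of_forall fun n x hx => ?_) hwp hwm hp hm⟩
    have h0 : chainSub T n m ≤ ⊥ := closedSpan_le (by
      rw [Submodule.bot_coe]; exact isClosed_singleton) fun k => k.elim
    rw [(Submodule.mem_bot ℂ).1 (h0 hx)]
    simp
  · set D := (closedSpan u)ᗮ with hDdef
    have hspan : ∀ x ∈ closedSpan u, A x ∈ closedSpan u := fun x hx =>
      map_mem_of_mem_closedSpan (isClosed_closedSpan u) A (fun n => by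
        rw [hAu]; exact Submodule.smul_mem _ _ (mem_closedSpan u n)) hx
    have hDc : IsClosed (D : Set H) := Submodule.isClosed_orthogonal _
    have hDinv : ∀ x ∈ D, A x ∈ D := fun x hx => invariant_orthogonal hA hspan hx
    obtain ⟨s, hs⟩ := exists_not_finite_spectralSub_inf hA hDc hDinv hD
    -- the essential spectrum leaves no choice for `s`
    have hsl : s = l := by
      have : (s : ℂ) ∈ essentialSpectrum A :=
        mem_essentialSpectrum_of_not_finite_spectralSub hA fun d hd hfin =>
          hs d hd (Submodule.finiteDimensional_of_le (S₂ := spectralSub A s d) inf_le_left)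
      rw [hess] at this
      exact Complex.ofReal_injective (Set.mem_singleton_iff.1 this)
    subst hsl
    obtain ⟨X, hX0, hXo, hXi, hXD, hX⟩ := exists_orthogonal_seq_spectralSub hA hDc hDinv hs
    set f : ℤ × ℤ × ℕ ≃ ℕ := Denumerable.eqv _ with hf
    set Z : (ℤ × ℤ × ℕ) ⊕ ℤ → Submodule ℂ H :=
      Sum.elim (fun j => X (f j)) (fun n => ℂ ∙ u n) with hZ
    set blk : (ℤ × ℤ × ℕ) ⊕ ℤ → ℤ × ℤ :=
      Sum.elim (fun j => (j.1, j.2.1)) (fun n => (n, n)) with hblk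
    have hXu : ∀ i n, X i ⟂ (ℂ ∙ u n) := fun i n => by
      rw [Submodule.isOrtho_iff_le]
      refine (hXD i).trans (Submodule.orthogonal_le ?_)
      exact (Submodule.span_singleton_le_iff_mem _ _).2 (mem_closedSpan u n)
    obtain ⟨T, S, hM, hch⟩ := exists_isShiftModel hA (Z := Z) (blk := blk) (u := u) (v := u)
      (w := w)
      (by
        rintro (j | n)
        · exact hX0 _
        · simpa [hZ] using hu.ne_zero n)
      (by
        rintro (i | i) (j | j) hij
        · exact hXo _ _ fun h => hij (by rw [f.injective h])
        · exact hXu _ _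
        · exact (hXu _ _).symm
        · simp only [hZ, Sum.elim_inr]
          rw [Submodule.isOrtho_span]
          rintro _ rfl _ rfl
          exact hu.2 fun h => hij (by rw [h]))
      (by
        rintro (j | n)
        · exact hXi _
        · intro x hx
          obtain ⟨a, rfl⟩ := Submodule.mem_span_singleton.1 hx
          rw [map_smul, hAu, smul_comm]
          exact Submodule.smul_mem _ _ hx)
      (fun ⟨n, m⟩ => Set.infinite_of_injective_forall_mem (f := fun k : ℕ => Sum.inl (n, m, k))
          (fun k l h => by simpa using h) fun k => by simp [hblk])
      hwne
      (fun n => Submodule.mem_iSup_of_mem (Sum.inr n)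
        (Submodule.mem_iSup_of_mem (by simp [hblk]) (Submodule.mem_span_singleton_self _)))
      hu.1 hu.1 hAu
    obtain ⟨U, hUs, hU⟩ := exists_unitarySpread_of_shift T S hM.position
    refine ⟨U, hUs, hM.pointSpectrum_eq_circle hU hA hinj hl (fun m d hd => ?_) hwp hwm hp hm⟩
    filter_upwards [eventually_forall_of_cofinite
      (f.injective.tendsto_cofinite.eventually (hX d hd)) (fun j => j.1),
      (Set.finite_singleton m).eventually_cofinite_notMem] with n hn hnm x hx
    refine norm_sub_le_of_mem_spectralSub hA hd (hch n m hnm _ (isClosed_spectralSub _ _ _) ?_ hx)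
    rintro (j | j) hj
    · exact hn j (Prod.mk.inj (show (j.1, j.2.1) = (n, m) from hj)).1
    · have := Prod.mk.inj (show (j, j) = (n, m) from hj)
      exact absurd (this.1.symm.trans this.2) hnm

/-- A finite-dimensional orthogonal complement of the main chain is diagonalised, and its
eigenvectors are inserted into the main chain before the vector with index `0`. -/
theorem exists_prepend_eigenvectors {A : H →L[ℂ] H} (hA : IsSelfAdjoint A) {l : ℝ}
    {u : ℤ → H} (hu : Orthonormal ℂ u) {w : ℤ → ℝ} (hAu : ∀ n, A (u n) = (w n : ℂ) • u n)
    (hD : FiniteDimensional ℂ ↥((closedSpan u)ᗮ))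
    (hwp : Tendsto (fun n : ℕ => w n) atTop (𝓝 l))
    (hp : Summable fun n : ℕ => ∏ k ∈ Finset.range (n + 1), (w k / l) ^ 2) :
    ∃ (u' : ℤ → H) (w' : ℤ → ℝ), Orthonormal ℂ u' ∧ (∀ n, A (u' n) = (w' n : ℂ) • u' n) ∧
      (closedSpan u')ᗮ = ⊥ ∧ Tendsto (fun n : ℕ => w' n) atTop (𝓝 l) ∧
      (Summable fun n : ℕ => ∏ k ∈ Finset.range (n + 1), (w' k / l) ^ 2) ∧
      ∀ n : ℕ, w' (-(n + 1)) = w (-(n + 1)) := by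
  set D := (closedSpan u)ᗮ with hDdef
  have hspan : ∀ x ∈ closedSpan u, A x ∈ closedSpan u := fun x hx =>
    map_mem_of_mem_closedSpan (isClosed_closedSpan u) A (fun n => by
      rw [hAu]; exact Submodule.smul_mem _ _ (mem_closedSpan u n)) hx
  have hDinv : ∀ x ∈ D, (A : H →ₗ[ℂ] H) x ∈ D := fun x hx => invariant_orthogonal hA hspan hx
  have hsym := (ContinuousLinearMap.isSelfAdjoint_iff_isSymmetric.1 hA).restrict_invariant hDinv
  set d := Module.finrank ℂ D with hd
  set e := hsym.eigenvectorBasis hd.symm with he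
  set μ := hsym.eigenvalues hd.symm with hμ
  have hAe : ∀ i, A (e i) = (μ i : ℂ) • (e i : H) := fun i =>
    congrArg Subtype.val (hsym.apply_eigenvectorBasis hd.symm i)
  have hsum : Orthonormal ℂ (Sum.elim (fun i => (e i : H)) u) := by
    have heo : Orthonormal ℂ fun i => (e i : H) := e.orthonormal.comp_linearIsometry D.subtypeₗᵢ
    constructor
    · rintro (i | n)
      exacts [heo.1 i, hu.1 n]
    · rintro (i | n) (j | m) hne
      · exact heo.2 fun h => hne (by rw [h])
      · exact inner_eq_zero_symm.1 (mem_orthogonal_closedSpan.1 (e i).2 m)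
      · exact mem_orthogonal_closedSpan.1 (e j).2 n
      · exact hu.2 fun h => hne (by rw [h])
  -- the new enumeration of the main chain: `…, u (-1), e 0, …, e (d - 1), u 0, u 1, …`
  set φ : ℤ → Fin d ⊕ ℤ := fun n => if h : 0 ≤ n ∧ n < d then Sum.inl ⟨n.toNat, by omega⟩
    else if 0 ≤ n then Sum.inr (n - d) else Sum.inr n with hφ
  have hφ1 : ∀ n : ℕ, φ ((n + d : ℕ) : ℤ) = Sum.inr (n : ℤ) := fun n => by
    simp only [hφ]
    rw [dif_neg (by push_cast; omega), if_pos (by positivity)]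
    push_cast
    ring_nf
  have hφ2 : ∀ n : ℤ, n < 0 → φ n = Sum.inr n := fun n hn => by
    simp only [hφ]
    rw [dif_neg (by omega), if_neg (by omega)]
  have hφ3 : ∀ i : Fin d, φ (i : ℕ) = Sum.inl i := fun i => by
    simp only [hφ]
    rw [dif_pos ⟨by positivity, by exact_mod_cast i.2⟩]
    simp
  have hφinj : Function.Injective φ := by
    intro a b hab
    simp only [hφ] at hab
    split_ifs at hab <;> simp at hab <;> omega
  have hφsurj : Function.Surjective φ := by
    rintro (i | n)
    · exact ⟨_, hφ3 i⟩
    · rcases le_or_gt 0 n with hn | hn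
      · refine ⟨((n.toNat + d : ℕ) : ℤ), ?_⟩
        rw [hφ1]
        congr 1
        omega
      · exact ⟨n, hφ2 n hn⟩
  have hshift : ∀ n : ℕ, Sum.elim μ w (φ ((n + d : ℕ) : ℤ)) = w n := fun n => by rw [hφ1]; rfl
  refine ⟨fun n => Sum.elim (fun i => (e i : H)) u (φ n), fun n => Sum.elim μ w (φ n),
    hsum.comp φ hφinj, fun n => ?_, ?_, ?_, ?_, fun n => ?_⟩
  · have h : ∀ j, A (Sum.elim (fun i => (e i : H)) u j) =
        ((Sum.elim μ w j : ℝ) : ℂ) • Sum.elim (fun i => (e i : H)) u j :=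
      Sum.rec hAe hAu
    exact h (φ n)
  · rw [Submodule.eq_bot_iff]
    intro x hx
    have h1 : ∀ j, inner ℂ (Sum.elim (fun i => (e i : H)) u j) x = 0 := fun j => by
      obtain ⟨n, rfl⟩ := hφsurj j
      exact mem_orthogonal_closedSpan.1 hx n
    have hxD : x ∈ D := mem_orthogonal_closedSpan.2 fun n => h1 (Sum.inr n)
    have h2 : (⟨x, hxD⟩ : D) = 0 := e.toHilbertBasis.eq_zero_of_inner fun i => by
      rw [e.coe_toHilbertBasis]
      exact h1 (Sum.inl i)
    exact congrArg Subtype.val h2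
  · rw [← tendsto_add_atTop_iff_nat d]
    exact hwp.congr fun n => (hshift n).symm
  · rw [← summable_nat_add_iff d]
    have := hp.mul_left (∏ k ∈ Finset.range d, (Sum.elim μ w (φ (k : ℕ)) / l) ^ 2)
    refine this.congr fun n => ?_
    rw [show n + d + 1 = d + (n + 1) by ring, 
      Finset.prod_range_add (fun k : ℕ => (Sum.elim μ w (φ (k : ℤ)) / l) ^ 2) d (n + 1)]
    congr 1
    refine Finset.prod_congr rfl fun k _ => ?_
    rw [add_comm d k, hshift]
  · change Sum.elim μ w (φ _) = _
    rw [hφ2 _ (by omega)]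
    rfl

/-- The spectral values `t k` and `r k`, which differ from the only point `l` of the essential
spectrum, are eigenvalues, and their eigenvectors form a main chain. -/
theorem exists_unitarySpread_circle_of_spectrum [TopologicalSpace.SeparableSpace H]
    {A : H →L[ℂ] H} (hA : IsSelfAdjoint A) (hinj : Function.Injective A) {l : ℝ} (hl : 0 < l)
    (hess : essentialSpectrum A = {(l : ℂ)}) {t r : ℕ → ℝ} (ht : ∀ k, (t k : ℂ) ∈ spectrum ℂ A)
    (hr : ∀ k, (r k : ℂ) ∈ spectrum ℂ A) (htm : ∀ k, t k < t (k + 1)) (hrm : ∀ k, r (k + 1) < r k)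
    (htl : Tendsto t atTop (𝓝 l)) (hrl : Tendsto r atTop (𝓝 l))
    (hp : Summable fun n : ℕ => ∏ k ∈ Finset.range (n + 1), (t k / l) ^ 2)
    (hm : Summable fun n : ℕ => ∏ k ∈ Finset.range (n + 1), (l / r k) ^ 2) :
    ∃ U : H →L[ℂ] H, IsUnitarySpread U ∧ pointSpectrum (U * A) = circleOfRadius l := by
  have htmono := strictMono_nat_of_lt_succ htm
  have hrmono := strictAnti_nat_of_succ_lt hrm
  have htlt : ∀ k, t k < l := fun k => (htm k).trans_le (htmono.monotone.ge_of_tendsto htl _)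
  have hrgt : ∀ k, l < r k := fun k => (hrmono.antitone.le_of_tendsto hrl _).trans_lt (hrm k)
  -- the main chain: eigenvectors for `t n` at `n ≥ 0`, for `r n` at `-(n + 1)`
  set w : ℤ → ℝ := fun n => match n with
    | Int.ofNat n => t n
    | Int.negSucc n => r n with hw
  have hwp : ∀ n : ℕ, w n = t n := fun n => rfl
  have hwm : ∀ n : ℕ, w (-(n + 1)) = r n := fun n => by rw [← Int.negSucc_eq]
  have hwinj : Function.Injective w := by
    rintro (a | a) (b | b) hab
    · exact congrArg _ (htmono.injective hab)
    · exact absurd (show t a = r b from hab) ((htlt a).trans (hrgt b)).ne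
    · exact absurd (show r a = t b from hab) ((htlt b).trans (hrgt a)).ne'
    · exact congrArg _ (hrmono.injective hab)
  have hex : ∀ n, ∃ x : H, ‖x‖ = 1 ∧ A x = (w n : ℂ) • x := by
    have hne : ∀ s : ℝ, s ≠ l → (s : ℂ) ∉ essentialSpectrum A := fun s hs h => by
      rw [hess] at h
      exact hs (Complex.ofReal_injective (Set.mem_singleton_iff.1 h))
    rintro (n | n)
    · exact exists_eigenvector_of_notMem_essentialSpectrum hA (ht n) (hne _ (htlt n).ne)
    · exact exists_eigenvector_of_notMem_essentialSpectrum hA (hr n) (hne _ (hrgt n).ne')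
  choose u hu1 hAu using hex
  have hu : Orthonormal ℂ u := ⟨hu1, fun i j hij =>
    inner_eq_zero_of_eigenvectors hA (hwinj.ne hij) (hAu i) (hAu j)⟩
  have hwp' : Tendsto (fun n : ℕ => w n) atTop (𝓝 l) := htl
  have hwm' : Tendsto (fun n : ℕ => w (-(n + 1))) atTop (𝓝 l) := by simpa only [hwm] using hrl
  have hp' : Summable fun n : ℕ => ∏ k ∈ Finset.range (n + 1), (w k / l) ^ 2 := hp
  have hm' : Summable fun n : ℕ => ∏ k ∈ Finset.range (n + 1), (l / w (-(k + 1))) ^ 2 := by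
    simpa only [hwm] using hm
  by_cases hD : FiniteDimensional ℂ ↥((closedSpan u)ᗮ)
  · obtain ⟨u', w', hu', hAu', hD', hwp'', hp'', hww⟩ :=
      exists_prepend_eigenvectors hA hu hAu hD hwp' hp'
    exact exists_unitarySpread_circle hA hinj hl hess hu' hAu' (Or.inl hD') hwp''
      (by simpa only [hww] using hwm') hp'' (by simpa only [hww] using hm')
  · exact exists_unitarySpread_circle hA hinj hl hess hu hAu (Or.inr hD) hwp' hwm' hp' hm'
end

/-! ### Eigenvalues of `U A` for an arbitrary unitary operator `U` -/

section
variable {H : Type u} [NormedAddCommGroup H] [InnerProductSpace ℂ H] [CompleteSpace H]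

/-- An orthonormal family in a separable space has at most as many members as a Hilbert basis. In
infinite dimensions both are countable, and in finite dimensions linear independence decides. -/
theorem mk_le_hilbertDim [TopologicalSpace.SeparableSpace H] {ι : Type} {v : ι → H}
    (hv : Orthonormal ℂ v) : Cardinal.lift.{u} (Cardinal.mk ι) ≤ hilbertDim H := by
  obtain ⟨b, -⟩ := (exists_hilbertBasis ℂ H).choose_spec
  rw [hilbertDim]
  rcases finite_or_infinite ↥(exists_hilbertBasis ℂ H).choose with hfin | hinf
  · have := Fintype.ofFinite ↥(exists_hilbertBasis ℂ H).choose
    rw [b.toOrthonormalBasis.toBasis.mk_eq_rank'']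
    simpa using hv.linearIndependent.cardinal_lift_le_rank
  · have := hv.countable_index
    refine le_trans ?_ (Cardinal.aleph0_le_mk _)
    rw [Cardinal.lift_le_aleph0]
    exact Cardinal.mk_le_aleph0

/-- A self-adjoint operator with spectrum in `[l₁, l₂]` is within `(l₂ - l₁) / 2` of the midpoint:
the whole space is the spectral subspace of this interval. -/
theorem norm_map_sub_center_le {A : H →L[ℂ] H} (hA : IsSelfAdjoint A) {l₁ l₂ : ℝ} (hl : l₁ < l₂)
    (hs : spectrum ℂ A ⊆ (fun s : ℝ => (s : ℂ)) '' Set.Icc l₁ l₂) (x : H) :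
    ‖A x - (((l₁ + l₂) / 2 : ℝ) : ℂ) • x‖ ≤ (l₂ - l₁) / 2 * ‖x‖ := by
  refine norm_sub_le_of_mem_spectralSub hA (by linarith) ?_
  have h0 : cfc (fun t : ℝ => max (|t - (l₁ + l₂) / 2| - (l₂ - l₁) / 2) 0) A = 0 := by
    rw [← cfc_const_zero ℝ A]
    refine cfc_congr fun t ht => ?_
    obtain ⟨s, ⟨h1, h2⟩, hst⟩ := hs (spectrum.algebraMap_mem ℂ ht)
    have : s = t := Complex.ofReal_injective hst
    subst this
    refine max_eq_right ?_
    rw [sub_nonpos, abs_le]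
    constructor <;> linarith
  rw [mem_spectralSub, h0]
  rfl

theorem norm_map_bounds {A : H →L[ℂ] H} (hA : IsSelfAdjoint A) {l₁ l₂ : ℝ} (hl₁ : 0 < l₁)
    (hl : l₁ < l₂) (hs : spectrum ℂ A ⊆ (fun s : ℝ => (s : ℂ)) '' Set.Icc l₁ l₂) (x : H) :
    l₁ * ‖x‖ ≤ ‖A x‖ ∧ ‖A x‖ ≤ l₂ * ‖x‖ := by
  have h := norm_map_sub_center_le hA hl hs x
  have h1 := norm_sub_norm_le (A x) ((((l₁ + l₂) / 2 : ℝ) : ℂ) • x)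
  have h2 := norm_sub_norm_le ((((l₁ + l₂) / 2 : ℝ) : ℂ) • x) (A x)
  rw [norm_sub_rev] at h2
  rw [norm_smul, Complex.norm_real, Real.norm_eq_abs, abs_of_pos (by linarith)] at h1 h2
  constructor <;> linarith

/-- A vector on which `A` attains one of the extreme dilatations `l₁`, `l₂` allowed by the spectrum
is an eigenvector. -/
theorem map_eq_smul_of_norm_map_eq {A : H →L[ℂ] H} (hA : IsSelfAdjoint A) {l₁ l₂ l : ℝ}
    (hl₁ : 0 < l₁) (hl : l₁ < l₂) (hs : spectrum ℂ A ⊆ (fun s : ℝ => (s : ℂ)) '' Set.Icc l₁ l₂)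
    (hll : l = l₁ ∨ l = l₂) {x : H} (hx : ‖A x‖ = l * ‖x‖) : A x = (l : ℂ) • x := by
  have h := norm_map_sub_center_le hA hl hs x
  have hexp : ∀ c : ℝ, ‖A x - (c : ℂ) • x‖ ^ 2 =
      ‖A x‖ ^ 2 - 2 * c * (inner ℂ (A x) x).re + c ^ 2 * ‖x‖ ^ 2 := fun c => by
    rw [@norm_sub_sq ℂ, inner_smul_right, norm_smul, Complex.norm_real, Real.norm_eq_abs, mul_pow,
      sq_abs]
    simp
    ring
  have h1 : ‖A x - (((l₁ + l₂) / 2 : ℝ) : ℂ) • x‖ ^ 2 ≤ ((l₂ - l₁) / 2 * ‖x‖) ^ 2 :=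
    pow_le_pow_left₀ (norm_nonneg _) h 2
  rw [hexp, hx] at h1
  have h2 := hexp l
  rw [hx] at h2
  have hlpos : 0 < l := by rcases hll with rfl | rfl <;> linarith
  have hprod : (l - l₁) * (l - l₂) = 0 := by rcases hll with rfl | rfl <;> ring
  -- `(l₁ + l₂) * ‖A x - l x‖ ^ 2 ≤ -2 * l * (l - l₁) * (l - l₂) * ‖x‖ ^ 2 = 0`
  have h3 : (l₁ + l₂) * ‖A x - (l : ℂ) • x‖ ^ 2 ≤ 0 := by
    have h4 : (l * ‖x‖) ^ 2 + l₁ * l₂ * ‖x‖ ^ 2 ≤ (l₁ + l₂) * (inner ℂ (A x) x).re := by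
      nlinarith
    have h5 := mul_le_mul_of_nonneg_left h4 (by linarith : 0 ≤ 2 * l)
    have h6 : (l - l₁) * (l - l₂) * (2 * l * ‖x‖ ^ 2) = 0 := by rw [hprod, zero_mul]
    rw [h2]
    nlinarith
  have h7 : ‖A x - (l : ℂ) • x‖ ^ 2 ≤ 0 := by
    by_contra! hpos
    have := mul_pos (show 0 < l₁ + l₂ by linarith) hpos
    linarith
  rw [← sub_eq_zero, ← norm_eq_zero]
  exact pow_eq_zero_iff (two_ne_zero) |>.1 (le_antisymm h7 (by positivity))

theorem pointSpectrum_mul_subset_closedRing {A : H →L[ℂ] H} (hA : IsSelfAdjoint A) {l₁ l₂ : ℝ}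
    (hl₁ : 0 < l₁) (hl : l₁ < l₂)
    (hs : spectrum ℂ A ⊆ (fun s : ℝ => (s : ℂ)) '' Set.Icc l₁ l₂) {U : H →L[ℂ] H}
    (hU : U ∈ unitary (H →L[ℂ] H)) : pointSpectrum (U * A) ⊆ closedRing l₁ l₂ := by
  intro z hz
  obtain ⟨x, hx, hx0⟩ := Module.End.HasEigenvalue.exists_hasEigenvector hz
  replace hx : U (A x) = z • x := Module.End.mem_eigenspace_iff.1 hx
  have h1 : ‖A x‖ = ‖z‖ * ‖x‖ := by
    rw [← ContinuousLinearMap.norm_map_of_mem_unitary hU, hx, norm_smul]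
  have h2 := norm_map_bounds hA hl₁ hl hs x
  rw [h1] at h2
  have hpos : 0 < ‖x‖ := norm_pos_iff.2 hx0
  exact ⟨le_of_mul_le_mul_right h2.1 hpos, le_of_mul_le_mul_right h2.2 hpos⟩

/-- Eigenvectors of `U A` for eigenvalues on an extreme circle are eigenvectors of `A` and of `U`,
and those for different eigenvalues are orthogonal because `U` is unitary. -/
theorem mk_pointSpectrum_inter_circle_le [TopologicalSpace.SeparableSpace H] {A : H →L[ℂ] H}
    (hA : IsSelfAdjoint A) {l₁ l₂ l : ℝ} (hl₁ : 0 < l₁) (hl : l₁ < l₂)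
    (hs : spectrum ℂ A ⊆ (fun s : ℝ => (s : ℂ)) '' Set.Icc l₁ l₂) (hll : l = l₁ ∨ l = l₂)
    {U : H →L[ℂ] H} (hU : U ∈ unitary (H →L[ℂ] H)) :
    Cardinal.lift.{u} (Cardinal.mk ↥(pointSpectrum (U * A) ∩ circleOfRadius l)) ≤
      hilbertDim ↥((l : ℂ) • ContinuousLinearMap.id ℂ H - A).ker := by
  have hlpos : 0 < l := by rcases hll with rfl | rfl <;> linarith
  have hex : ∀ z : ↥(pointSpectrum (U * A) ∩ circleOfRadius l), ∃ x : H, ‖x‖ = 1 ∧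
      A x = (l : ℂ) • x ∧ (l : ℂ) • U x = (z : ℂ) • x := by
    rintro ⟨z, hz, hzl⟩
    replace hzl : ‖z‖ = l := hzl
    obtain ⟨x, hx, hx0⟩ := Module.End.HasEigenvalue.exists_hasEigenvector hz
    replace hx : U (A x) = z • x := Module.End.mem_eigenspace_iff.1 hx
    have h1 : A x = (l : ℂ) • x := map_eq_smul_of_norm_map_eq hA hl₁ hl hs hll (by
      rw [← ContinuousLinearMap.norm_map_of_mem_unitary hU, hx, norm_smul, hzl])
    refine ⟨((‖x‖ : ℂ))⁻¹ • x, by exact_mod_cast norm_smul_inv_norm (𝕜 := ℂ) hx0, ?_, ?_⟩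
    · rw [map_smul, h1, smul_comm]
    · rw [map_smul, smul_comm, ← map_smul, ← h1, hx, smul_comm]
  choose x hx1 hAx hUx using hex
  have hker : ∀ z, x z ∈ ((l : ℂ) • ContinuousLinearMap.id ℂ H - A).ker := fun z => by
    change ((l : ℂ) • ContinuousLinearMap.id ℂ H - A) (x z) = 0
    simp [hAx]
  refine mk_le_hilbertDim (v := fun z => (⟨x z, hker z⟩ :
    ↥((l : ℂ) • ContinuousLinearMap.id ℂ H - A).ker)) ⟨fun z => hx1 z, fun z z' hne => ?_⟩
  change inner ℂ (x z) (x z') = 0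
  by_contra h
  have hzl : ‖(z : ℂ)‖ = l := z.2.2
  have h1 : inner ℂ ((l : ℂ) • U (x z)) ((l : ℂ) • U (x z')) =
      inner ℂ ((z : ℂ) • x z) ((z' : ℂ) • x z') := by rw [hUx, hUx]
  simp only [inner_smul_left, inner_smul_right, Complex.conj_ofReal,
    ContinuousLinearMap.inner_map_map_of_mem_unitary hU] at h1
  rw [← mul_assoc, ← mul_assoc] at h1
  have h2 := mul_right_cancel₀ h h1
  have h3 : (starRingEnd ℂ) (z : ℂ) * z = l * l := by
    rw [mul_comm, Complex.mul_conj, Complex.normSq_eq_norm_sq, hzl]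
    push_cast
    ring
  rw [← h3, mul_comm ((z' : ℂ))] at h2
  have hz0 : (starRingEnd ℂ) (z : ℂ) ≠ 0 := by
    rw [Ne, map_eq_zero, ← norm_eq_zero, hzl]
    exact hlpos.ne'
  exact hne (Subtype.ext (mul_left_cancel₀ hz0 h2))
end

theorem mainTheorem2 {H : Type u} [NormedAddCommGroup H] [InnerProductSpace ℂ H]
    [CompleteSpace H] [TopologicalSpace.SeparableSpace H]
    (A : H →L[ℂ] H) (hA : IsSelfAdjoint A) :
    -- part (i)
    (∀ l₁ l₂ : ℝ, 0 < l₁ →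
      spectrum ℂ A ⊆ (fun s : ℝ => (s : ℂ)) '' Set.Icc l₁ l₂ →
      (l₁ : ℂ) ∈ essentialSpectrum A → (l₂ : ℂ) ∈ essentialSpectrum A →
      ∀ a b : ℝ, l₁ ≤ a → a < b → b ≤ l₂ →
        ∃ U : H →L[ℂ] H, IsUnitarySpread U ∧ pointSpectrum (U * A) = openRing a b) ∧
    -- part (ii)
    (∀ l₁ l₂ : ℝ, 0 < l₁ → l₁ < l₂ →
      (l₁ : ℂ) ∈ essentialSpectrum A → (l₂ : ℂ) ∈ essentialSpectrum A →
      (∃ U : H →L[ℂ] H, IsUnitarySpread U ∧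
        ∀ a b : ℝ, l₁ ≤ a → a < b → b ≤ l₂ → openRing a b ⊆ pointSpectrum (U * A)) ∧
      (Function.Injective A →
        (∃ t r : ℕ → ℝ, (∀ k, (t k : ℂ) ∈ spectrum ℂ A) ∧ (∀ k, (r k : ℂ) ∈ spectrum ℂ A) ∧
          (∀ k, t (k + 1) < t k) ∧ (∀ k, r k < r (k + 1))) →
        ∀ a b : ℝ, l₁ ≤ a → a < b → b ≤ l₂ →
          ∃ U : H →L[ℂ] H, IsUnitarySpread U ∧ pointSpectrum (U * A) = openRing a b) ∧
      (spectrum ℂ A ⊆ (fun s : ℝ => (s : ℂ)) '' Set.Icc l₁ l₂ →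
        ∀ U ∈ unitary (H →L[ℂ] H),
          pointSpectrum (U * A) ⊆ closedRing l₁ l₂ ∧
          ∀ l : ℝ, l = l₁ ∨ l = l₂ →
            Cardinal.lift.{u} (Cardinal.mk ↥(pointSpectrum (U * A) ∩ circleOfRadius l)) ≤
              hilbertDim ↥((l : ℂ) • ContinuousLinearMap.id ℂ H - A).ker)) ∧
    -- part (iii)
    (∀ l₁ : ℝ, 0 < l₁ → Function.Injective A →
      essentialSpectrum A = {(l₁ : ℂ)} →
      ∀ t r : ℕ → ℝ, (∀ k, (t k : ℂ) ∈ spectrum ℂ A) → (∀ k, (r k : ℂ) ∈ spectrum ℂ A) →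
        (∀ k, t k < t (k + 1)) → (∀ k, r (k + 1) < r k) →
        Tendsto t atTop (𝓝 l₁) → Tendsto r atTop (𝓝 l₁) →
        Summable (fun n : ℕ => ∏ k ∈ Finset.range (n + 1), (t k / l₁) ^ 2) →
        Summable (fun n : ℕ => ∏ k ∈ Finset.range (n + 1), (l₁ / r k) ^ 2) →
        ∃ U : H →L[ℂ] H, IsUnitarySpread U ∧ pointSpectrum (U * A) = circleOfRadius l₁) := by
  refine ⟨fun l₁ l₂ hl₁ hs h₁ h₂ a b ha hab hb => ?_, fun l₁ l₂ hl₁ hl h₁ h₂ => ⟨?_, ?_, ?_⟩, ?_⟩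
  · obtain ⟨U, hU, hsub, hsup⟩ := exists_unitarySpread_ring hA hl₁ h₁ h₂ ha hab hb
    refine ⟨U, hU, (hsup ?_).antisymm hsub⟩
    refine (injective_iff_map_eq_zero A).2 fun x hx => norm_le_zero_iff.1 ?_
    have h := (norm_map_bounds hA hl₁ (by linarith) hs x).1
    rw [hx, norm_zero] at h
    exact nonpos_of_mul_nonpos_right h hl₁
  · obtain ⟨U, hU, hsub, -⟩ := exists_unitarySpread_ring hA hl₁ h₁ h₂ le_rfl hl le_rfl
    exact ⟨U, hU, fun a b ha _ hb z hz => hsub ⟨ha.trans_lt hz.1, hz.2.trans_le hb⟩⟩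
  · intro hinj _ a b ha hab hb
    obtain ⟨U, hU, hsub, hsup⟩ := exists_unitarySpread_ring hA hl₁ h₁ h₂ ha hab hb
    exact ⟨U, hU, (hsup hinj).antisymm hsub⟩
  · exact fun hs U hU => ⟨pointSpectrum_mul_subset_closedRing hA hl₁ hl hs hU,
      fun l hll => mk_pointSpectrum_inter_circle_le hA hl₁ hl hs hll hU⟩
  · exact fun l₁ hl₁ hinj hess t r ht hr htm hrm htl hrl hp hm =>
      exists_unitarySpread_circle_of_spectrum hA hinj hl₁ hess ht hr htm hrm htl hrl hp hm
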